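/- Let $N\ge 1$, $\alpha\in\mathbb{Z}/N\mathbb{Z}$ (in a power, $\alpha$ stands for its representative in $\{0,\dots,N-1\}$), $r\ge 0$, let $\eta_1,\dots,\eta_r\in\mathbb{C}$ be $N$-th roots of unity, put $\eta_{r+1}:=1$, and let $k_1,\dots,k_r$ be positive integers. For complex numbers $a_1,\dots,a_m\in\{0\}\cup\mu_N$ let $I(a_1,\dots,a_m)$ be the regularized iterated integral, i.e. the constant term $P(0)$ of the unique polynomial $P$ with $$\int_{z<t_1<\cdots<t_m<1-z}\prod_{i=1}^m\frac{dt_i}{t_i-a_i}=P(\log z)+o(1)\qquad(z\to+0),$$ and, for $\xi_1,\dots,\xi_s\in\mu_N$ and positive integers $l_1,\dots,l_s$, let $$L^{\mathrm{sh}}\binom{\xi_1,\dots,\xi_s}{l_1,\dots,l_s}:=(-1)^sI\bigl(\xi_1^{-1},\{0\}^{l_1-1},\dots,\xi_s^{-1},\{0\}^{l_s-1}\bigr)$$ be the shuffle-regularized multiple $L$-value (equal to $1$ for $s=0$). Put $$L^{\mathrm{sh}}_{\widehat{\mathcal S},\alpha}\binom{\boldsymbol\eta}{\mathbf k}:=\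sum_{i=0}^r(-1)^{k_{i+1}+\cdots+k_r}\eta_{i+1}^{\alpha}\,L^{\mathrm{sh}}\binom{\eta_1/\eta_{i+1},\dots,\eta_i/\eta_{i+1}}{k_1,\dots,k_i}\sum_{f_{i+1},\dots,f_r\ge0}\Bigl(\prod_{j=i+1}^r\binom{k_j+f_j-1}{f_j}\Bigr)L^{\mathrm{sh}}\binom{1/\eta_{i+1},\eta_r/\eta_{i+1},\dots,\eta_{i+2}/\eta_{i+1}}{k_r+f_r,\dots,k_{i+1}+f_{i+1}}t^{f_{i+1}+\cdots+f_r}\in\mathbb{C}[[t]].$$ The $t$-adic symmetric multiple polylogarithm at $\boldsymbol\eta$ is the same expression with each $L^{\mathrm{sh}}$ replaced by the series $\mathrm{Li}\binom{x_1,\dots,x_s}{l_1,\dots,l_s}=\sum_{0<n_1<\cdots<n_s}\frac{x_1^{n_1}x_2^{n_2-n_1}\cdots x_s^{n_s-n_{s-1}}}{n_1^{l_1}\cdots n_s^{l_s}}$, summed as follows. For $M\ge1$, let $\text{\pounds}_{\widehat{\mathcal S},\alpha,<M}\binom{\boldsymbol\eta}{\mathbf k}\in\mathbb{C}[[t]]$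 be the partial sum in which, in the $i$-th summand, only those terms are kept for which $n_i+m_{i+1}<M$; here $0<n_1<\cdots<n_i$ and $0<m_r<\cdots<m_{i+1}$ are the summation variables of the first and the second series, and $n_0=m_{r+1}=0$. The value $\text{\pounds}_{\widehat{\mathcal S},\alpha}\binom{\boldsymbol\eta}{\mathbf k}$ is the coefficientwise limit for $M\to\infty$. For a subfield $K\subseteq\mathbb{C}$ let $\mathcal{Z}_N^K$ be the $K$-linear span of all $L^{\mathrm{sh}}\binom{\boldsymbol\xi}{\mathbf l}$ with $s\ge0$, $\boldsymbol\xi\in\mu_N^s$, $\mathbf l\in\mathbb{Z}_{\ge1}^s$. If $K$ contains $\eta_1^\alpha,\dots,\eta_r^\alpha$ (e.g. $K=\mathbb{Q}$ if $\alpha=0$, and $K=\mathbb{Q}(\mu_N)$ in general), the $t$-adic symmetric multiple $L$-value $L_{\widehat{\mathcal S},\alpha}\binom{\boldsymbol\eta}{\mathbf k}$ is the class of $L^{\mathrm{sh}}_{\widehat{\mathcal S},\alpha}\binom{\boldsymbol\eta}{\mathbf k}$ in $(\mathcal{Z}_N^K/\pi^2\mathcal{Z}_N^K)[[t]]$. **Lemma.**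 For every $n\ge0$ the coefficient of $t^n$ in $\text{\pounds}_{\widehat{\mathcal S},\alpha,<M}\binom{\boldsymbol\eta}{\mathbf k}$ converges as $M\to\infty$. The limit $\text{\pounds}_{\widehat{\mathcal S},\alpha}\binom{\boldsymbol\eta}{\mathbf k}\in\mathbb{C}[[t]]$ equals $L^{\mathrm{sh}}_{\widehat{\mathcal S},\alpha}\binom{\boldsymbol\eta}{\mathbf k}$. For every subfield $K$ as above, its coefficients lie in $\mathcal{Z}_N^K$, and its class in $(\mathcal{Z}_N^K/\pi^2\mathcal{Z}_N^K)[[t]]$ is $L_{\widehat{\mathcal S},\alpha}\binom{\boldsymbol\eta}{\mathbf k}$. -/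

import Mathlib

open Filter Topology
open scoped Classical

noncomputable section

namespace TAdicSymmetric

/-! ### Regularized iterated integrals along the straight path from `0` to `1` -/

/-- The iterated integral `∫_{p < t₁ < ⋯ < t_m < q} ∏ dt_i / (t_i - a_i)`, where the letters are
listed in the order `[a_m, …, a₁]`: the head of the list belongs to the largest variable. -/
def iterIntRev : List ℂ → ℝ → ℝ → ℂ
  | [], _, _ => 1
  | a :: w, p, q => ∫ t in p..q, iterIntRev w p t / ((t : ℂ) - a)

/-- The iterated integral `∫_{p < t₁ < ⋯ < t_m < q} ∏ dt_i / (t_i - a_i)` of `w = [a₁, …, a_m]`. -/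
def iterInt (w : List ℂ) (p q : ℝ) : ℂ := iterIntRev w.reverse p q

/-- `P` is the part of order `z ^ 0` in the asymptotic expansion in powers of `z` and `log z`
of the integral over `z < t₁ < ⋯ < t_m < 1 - z`, as `z → +0`. Such a `P` is unique. -/
def IsLogExpansion (w : List ℂ) (P : Polynomial ℂ) : Prop :=
  Tendsto (fun z : ℝ => iterInt w z (1 - z) - P.eval ((Real.log z : ℝ) : ℂ)) (𝓝[>] 0) (𝓝 0)

/-- The regularized iterated integral `I_dch(0; e_{a₁} ⋯ e_{a_m}; 1)` between the tangential base
points `(0, 1)` and `(1, -1)`: the coefficient of `(log z)^0 z^0` in the asymptotic expansion. -/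
def regInt (w : List ℂ) : ℂ :=
  if h : ∃ P : Polynomial ℂ, IsLogExpansion w P then h.choose.coeff 0 else 0

/-- The word `e_{1/x₁} e₀^{k₁-1} ⋯ e_{1/x_r} e₀^{k_r-1}`. -/
def word {r : ℕ} (x : Fin r → ℂ) (k : Fin r → ℕ) : List ℂ :=
  (List.ofFn fun j => (x j)⁻¹ :: List.replicate (k j - 1) 0).flatten

/-- The shuffle-regularized multiple `L`-value. -/
def Lsh {r : ℕ} (x : Fin r → ℂ) (k : Fin r → ℕ) : ℂ :=
  (-1) ^ r * regInt (word x k)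

/-! ### The terms of the multiple polylogarithm series -/

/-- The predecessor `n_{j-1}` of the entry `n_j`, with `n_0 = 0` before the first entry. -/
def prevEntry {r : ℕ} (n : Fin r → ℕ) (j : Fin r) : ℕ :=
  if 0 < j.val then n ⟨j.val - 1, by omega⟩ else 0

/-- `x₁^{n₁} x₂^{n₂-n₁} ⋯ x_r^{n_r-n_{r-1}} / (n₁^{k₁} ⋯ n_r^{k_r})`. -/
def liTerm {r : ℕ} (x : Fin r → ℂ) (k n : Fin r → ℕ) : ℂ :=
  ∏ j, x j ^ (n j - prevEntry n j) / (n j : ℂ) ^ k j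

/-- The tuples `0 < n₁ < ⋯ < n_r < M`. -/
def incTuples (r M : ℕ) : Finset (Fin r → ℕ) :=
  (Fintype.piFinset fun _ => Finset.Ico 1 M).filter StrictMono

/-- The largest entry `n_r` of an increasing tuple (`0` for the empty tuple). -/
def top {r : ℕ} (n : Fin r → ℕ) : ℕ := Finset.univ.sup n

/-- The partial sum of the product of two series `Li(x; k) · Li(y; l)` over all pairs of tuples
`0 < n₁ < ⋯ < n_a`, `0 < m₁ < ⋯ < m_b` with `n_a + m_b < M`. -/
def liProdTrunc {a b : ℕ} (M : ℕ) (x : Fin a → ℂ) (k : Fin a → ℕ)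
    (y : Fin b → ℂ) (l : Fin b → ℕ) : ℂ :=
  ∑ p ∈ (incTuples a M ×ˢ incTuples b M).filter (fun p => top p.1 + top p.2 < M),
    liTerm x k p.1 * liTerm y l p.2

/-! ### The symmetric construction

Entries are numbered from `0`, so `x_{i+1}` of the usual notation is `extend x i`; moreover
`x_{r+1} = 1`. -/

/-- `x` continued by `1`. -/
def extend {r : ℕ} (x : Fin r → ℂ) (j : ℕ) : ℂ := if h : j < r then x ⟨j, h⟩ else 1

/-- `(x₁/x_{i+1}, …, x_i/x_{i+1})`. -/
def leftArg {r : ℕ} (x : Fin r → ℂ) (i : Fin (r + 1)) : Fin i.val → ℂ :=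
  fun j => x ⟨j.val, by omega⟩ / extend x i

/-- `(k₁, …, k_i)`. -/
def leftIdx {r : ℕ} (k : Fin r → ℕ) (i : Fin (r + 1)) : Fin i.val → ℕ :=
  fun j => k ⟨j.val, by omega⟩

/-- `(1/x_{i+1}, x_r/x_{i+1}, …, x_{i+2}/x_{i+1})`. -/
def rightArg {r : ℕ} (x : Fin r → ℂ) (i : Fin (r + 1)) : Fin (r - i.val) → ℂ :=
  fun j => extend x (r - j.val) / extend x i

/-- `(k_r, …, k_{i+1})`. -/
def rightIdx {r : ℕ} (k : Fin r → ℕ) (i : Fin (r + 1)) : Fin (r - i.val) → ℕ :=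
  fun j => k ⟨r - 1 - j.val, by omega⟩

/-- The partial sum, up to `M`, of the `t`-adic symmetric multiple polylogarithm at `x`, as a power
series in `t`: in the `i`-th summand only the terms with `n_i + m_{i+1} < M` are kept, where
`0 < n₁ < ⋯ < n_i` and `0 < m_r < ⋯ < m_{i+1}` are the summation variables of its two factors. -/
def polylogTrunc {r : ℕ} (a : ℕ) (x : Fin r → ℂ) (k : Fin r → ℕ) (M : ℕ) : PowerSeries ℂ :=
  PowerSeries.mk fun d => ∑ i : Fin (r + 1),
    (-1) ^ (∑ j, rightIdx k i j) * extend x i ^ a *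
      ∑ f ∈ Finset.piAntidiag (Finset.univ : Finset (Fin (r - i.val))) d,
        ((∏ j, (rightIdx k i j + f j - 1).choose (f j) : ℕ) : ℂ) *
          liProdTrunc M (leftArg x i) (leftIdx k i) (rightArg x i) (rightIdx k i + f)

/-- The power series in `t` built from shuffle-regularized multiple `L`-values whose class is
the `t`-adic symmetric multiple `L`-value. -/
def LSymSh {r : ℕ} (a : ℕ) (x : Fin r → ℂ) (k : Fin r → ℕ) : PowerSeries ℂ :=
  PowerSeries.mk fun d => ∑ i : Fin (r + 1),
    (-1) ^ (∑ j, rightIdx k i j) * extend x i ^ a *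
      (Lsh (leftArg x i) (leftIdx k i) *
        ∑ f ∈ Finset.piAntidiag (Finset.univ : Finset (Fin (r - i.val))) d,
          ((∏ j, (rightIdx k i j + f j - 1).choose (f j) : ℕ) : ℂ) *
            Lsh (rightArg x i) (rightIdx k i + f))

/-! ### The space of multiple `L`-values and the quotient by `π²` -/

/-- The `K`-span of the multiple `L`-values of level `N` (the empty index gives `1`). -/
def LSpace (K : Subfield ℂ) (N : ℕ) : Submodule K ℂ :=
  Submodule.span K {c | ∃ (s : ℕ) (ξ : Fin s → ℂ) (l : Fin s → ℕ),
    (∀ j, ξ j ^ N = 1) ∧ (∀ j, 1 ≤ l j) ∧ c = Lsh ξ l}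

/-- `π²` times the span of the multiple `L`-values. -/
def piSqLSpace (K : Subfield ℂ) (N : ℕ) : Submodule K ℂ :=
  (LSpace K N).map (LinearMap.mulLeft K ((Real.pi : ℂ) ^ 2))

/-- The `t`-adic symmetric multiple `L`-value, as its sequence of coefficients modulo
`π² · LSpace K N`. The quotient of `LSpace K N` sits inside `ℂ ⧸ piSqLSpace K N`. -/
def LSym {r : ℕ} (K : Subfield ℂ) (N : ℕ) (α : ZMod N) (η : Fin r → ℂ) (k : Fin r → ℕ) :
    ℕ → ℂ ⧸ piSqLSpace K N :=
  fun d => (piSqLSpace K N).mkQ (PowerSeries.coeff d (LSymSh α.val η k))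

end TAdicSymmetric

end

/-!
The Taylor coefficients at `0` of iterated integrals (`liCoeff`) multiply by the shuffle product as
long as no word ends in the letter `0`. Hence the partial sum over `n + m < M` of a product of two
series is, up to sign, a sum over the shuffles of two words of partial sums of single Taylor series
at `1`.

Integrating letter by letter, one finds that every such Taylor series is, as its argument tends to
`1`, a polynomial in `log (1 - t)` up to `O(√(1 - t))`. The constant terms of these polynomials are
the regularized integrals, and so these obey the same shuffle product formula. The difference of the
partial sums and the symmetric construction is therefore a sum of errors over shuffles.

The error of a word not starting with `1` (the letter of the largest variable is written first)
tends to `0` by Abel's limit theorem. The errors of the words starting with `1` cancel exactly, for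
every `M`: removal of a leading `1` is a derivation of the shuffle product, and it leads from the
summands `i` and `i + 1` of the symmetric construction to the same pairs of words, with opposite
signs.
-/

noncomputable section

namespace TAdicSymmetric

/-! ### Shuffles of words -/

section Shuffle

variable {A E : Type*}

/-- The list of all shuffles of two words, with multiplicity. -/
def shuffles : List A → List A → List (List A)
  | [], v => [v]
  | a :: u, [] => [a :: u]
  | a :: u, b :: v =>
    (shuffles u (b :: v)).map (a :: ·) ++ (shuffles (a :: u) v).map (b :: ·)
termination_by u v => u.length + v.length

theorem shuffles_nil_left (v : List A) : shuffles [] v = [v] := by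
  rw [shuffles]

theorem shuffles_nil_right (u : List A) : shuffles u [] = [u] := by
  cases u <;> rw [shuffles]

theorem shuffles_cons_cons (a b : A) (u v : List A) :
    shuffles (a :: u) (b :: v) =
      (shuffles u (b :: v)).map (a :: ·) ++ (shuffles (a :: u) v).map (b :: ·) := by
  rw [shuffles]

theorem perm_append_of_mem_shuffles {u v w : List A} (h : w ∈ shuffles u v) :
    w.Perm (u ++ v) := by
  induction u, v using shuffles.induct generalizing w with
  | case1 v => simp_all [shuffles_nil_left]
  | case2 a u => simp_all [shuffles_nil_right]
  | case3 a u b v ih₁ ih₂ =>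
    simp only [shuffles_cons_cons, List.mem_append, List.mem_map] at h
    rcases h with ⟨w, hw, rfl⟩ | ⟨w, hw, rfl⟩
    · exact (ih₁ hw).cons a
    · exact ((ih₂ hw).cons b).trans List.perm_middle.symm

theorem forall_mem_of_mem_shuffles {p : A → Prop} {u v w : List A} (hu : ∀ a ∈ u, p a)
    (hv : ∀ a ∈ v, p a) (hw : w ∈ shuffles u v) : ∀ a ∈ w, p a := fun a ha =>
  (List.mem_append.1 ((perm_append_of_mem_shuffles hw).mem_iff.1 ha)).elim (hu a) (hv a)

/-- The sum of the values of a function on words over all shuffles of two words, that is, the value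
of its linear extension at the shuffle product. -/
def shuffleSum [AddCommMonoid E] (φ : List A → E) (u v : List A) : E :=
  ((shuffles u v).map φ).sum

/-- The dual of the left multiplication by a letter `a`: the function `ψ` evaluated at the tail of
a word with head `a`, and `0` at all other words. -/
def onHead [Zero E] (a : A) (ψ : List A → E) : List A → E
  | [] => 0
  | b :: w => if b = a then ψ w else 0

variable [AddCommMonoid E]

theorem shuffleSum_nil_left (φ : List A → E) (v : List A) : shuffleSum φ [] v = φ v := by
  simp [shuffleSum, shuffles_nil_left]

theorem shuffleSum_nil_right (φ : List A → E) (u : List A) : shuffleSum φ u [] = φ u := by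
  simp [shuffleSum, shuffles_nil_right]

theorem shuffleSum_cons_cons (φ : List A → E) (a b : A) (u v : List A) :
    shuffleSum φ (a :: u) (b :: v) =
      shuffleSum (fun w => φ (a :: w)) u (b :: v) +
        shuffleSum (fun w => φ (b :: w)) (a :: u) v := by
  simp [shuffleSum, shuffles_cons_cons, Function.comp_def]

theorem map_shuffleSum {E' G : Type*} [AddCommMonoid E'] [FunLike G E E'] [AddMonoidHomClass G E E']
    (g : G) (φ : List A → E) (u v : List A) :
    g (shuffleSum φ u v) = shuffleSum (fun w => g (φ w)) u v := by
  simp [shuffleSum, map_list_sum, Function.comp_def]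

theorem shuffleSum_congr {φ ψ : List A → E} {u v : List A}
    (h : ∀ w ∈ shuffles u v, φ w = ψ w) : shuffleSum φ u v = shuffleSum ψ u v := by
  rw [shuffleSum, shuffleSum, List.map_congr_left h]

theorem shuffleSum_zero (u v : List A) : shuffleSum (fun _ => (0 : E)) u v = 0 := by
  simp [shuffleSum]

theorem shuffleSum_add (φ ψ : List A → E) (u v : List A) :
    shuffleSum (fun w => φ w + ψ w) u v = shuffleSum φ u v + shuffleSum ψ u v := by
  simp [shuffleSum, List.sum_map_add]

theorem shuffleSum_sub {G : Type*} [AddCommGroup G] (φ ψ : List A → G) (u v : List A) :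
    shuffleSum (fun w => φ w - ψ w) u v = shuffleSum φ u v - shuffleSum ψ u v := by
  rw [eq_sub_iff_add_eq, ← shuffleSum_add]
  simp only [sub_add_cancel]

theorem tendsto_shuffleSum [TopologicalSpace E] [ContinuousAdd E] {ι : Type*} {l : Filter ι}
    {φ : ι → List A → E} {ψ : List A → E} {u v : List A}
    (h : ∀ w ∈ shuffles u v, Tendsto (fun i => φ i w) l (𝓝 (ψ w))) :
    Tendsto (fun i => shuffleSum (φ i) u v) l (𝓝 (shuffleSum ψ u v)) :=
  tendsto_list_sum _ h

theorem hasSum_shuffleSum [TopologicalSpace E] [ContinuousAdd E] {ι : Type*}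
    {φ : ι → List A → E} {ψ : List A → E} {u v : List A}
    (h : ∀ w ∈ shuffles u v, HasSum (fun i => φ i w) (ψ w)) :
    HasSum (fun i => shuffleSum (φ i) u v) (shuffleSum ψ u v) := by
  have sum_shuffleSum (s : Finset ι) : ∑ i ∈ s, shuffleSum (φ i) u v =
      shuffleSum (fun w => ∑ i ∈ s, φ i w) u v := by
    simp only [shuffleSum]
    induction shuffles u v with simp_all [Finset.sum_add_distrib]
  simpa only [HasSum, sum_shuffleSum] using tendsto_shuffleSum h

theorem onHead_cons (a b : A) (ψ : List A → E) (w : List A) :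
    onHead a ψ (b :: w) = if b = a then ψ w else 0 :=
  rfl

theorem shuffleSum_onHead_cons (a b : A) (ψ : List A → E) (u v : List A) :
    shuffleSum (fun w => onHead a ψ (b :: w)) u v = if b = a then shuffleSum ψ u v else 0 := by
  by_cases hb : b = a <;> simp [onHead_cons, hb, shuffleSum_zero]

theorem shuffleSum_onHead (a : A) (ψ : List A → E) (u v : List A) :
    shuffleSum (onHead a ψ) u v =
      onHead a (fun w => shuffleSum ψ w v) u + onHead a (fun w => shuffleSum ψ u w) v := by
  cases u with
  | nil => cases v <;> simp [onHead, shuffleSum_nil_left]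
  | cons b u =>
    cases v with
    | nil => simp [onHead, shuffleSum_nil_right]
    | cons c v =>
      rw [shuffleSum_cons_cons, shuffleSum_onHead_cons, shuffleSum_onHead_cons, onHead_cons,
        onHead_cons]

end Shuffle

/-- The words whose last entry is not `0`. Words are written with the letter of the largest
variable first, as in `iterIntRev`, so that these are the words whose iterated integral converges
at `0`. -/
def Admissible {A : Type*} [Zero A] : List A → Prop
  | [] => True
  | a :: w => (w = [] → a ≠ 0) ∧ Admissible w

theorem Admissible.of_mem_shuffles {A : Type*} [Zero A] {u v w : List A} (hu : Admissible u)
    (hv : Admissible v) (h : w ∈ shuffles u v) : Admissible w := by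
  induction u, v using shuffles.induct generalizing w with
  | case1 v => simp_all [shuffles_nil_left]
  | case2 a u => simp_all [shuffles_nil_right]
  | case3 a u b v ih₁ ih₂ =>
    simp only [shuffles_cons_cons, List.mem_append, List.mem_map] at h
    rcases h with ⟨w, hw, rfl⟩ | ⟨w, hw, rfl⟩
    · exact ⟨by rintro rfl; simpa using (perm_append_of_mem_shuffles hw).length_eq,
        ih₁ hu.2 hv hw⟩
    · exact ⟨by rintro rfl; simpa using (perm_append_of_mem_shuffles hw).length_eq,
        ih₂ hu hv.2 hw⟩

/-! ### Taylor series of iterated integrals -/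

section TaylorSeries

variable {F : Type*} [Field F]

/-- The Taylor coefficients at `0` of `q ↦ iterIntRev w 0 q`, over an arbitrary field. -/
def liCoeff : List F → ℕ → F
  | [], n => if n = 0 then 1 else 0
  | a :: w, n =>
    if a = 0 then liCoeff w n / n
    else -(∑ m ∈ Finset.range n, liCoeff w m * a⁻¹ ^ (n - m)) / n

theorem liCoeff_cons_zero (a : F) (w : List F) : liCoeff (a :: w) 0 = 0 := by
  simp [liCoeff]

theorem sum_range_mul_pow_succ_sub (c : ℕ → F) (y : F) (n : ℕ) :
    ∑ m ∈ Finset.range (n + 1), c m * y ^ (n + 1 - m) =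
      y * (∑ m ∈ Finset.range n, c m * y ^ (n - m) + c n) := by
  rw [Finset.sum_range_succ, mul_add, Finset.mul_sum]
  congr 1
  · refine Finset.sum_congr rfl fun m hm => ?_
    rw [Nat.sub_add_comm (Finset.mem_range.1 hm).le, pow_succ]
    ring
  · simp [mul_comm]

/-- The Taylor series at `0` of `q ↦ iterIntRev w 0 q`. -/
def liSeries (w : List F) : PowerSeries F := PowerSeries.mk (liCoeff w)

open PowerSeries

theorem liSeries_nil : liSeries ([] : List F) = 1 := by
  ext n
  simp [liSeries, liCoeff, coeff_one]

theorem constantCoeff_liSeries_cons (a : F) (w : List F) :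
    constantCoeff (liSeries (a :: w)) = 0 := by
  simp [liSeries, liCoeff_cons_zero]

variable [CharZero F]

theorem mul_liCoeff_zero_cons {w : List F} (hw : w ≠ []) (n : ℕ) :
    n * liCoeff (0 :: w) n = liCoeff w n := by
  rcases Nat.eq_zero_or_pos n with rfl | hn
  · obtain ⟨b, w, rfl⟩ := List.exists_cons_of_ne_nil hw
    simp [liCoeff_cons_zero]
  · simp [liCoeff, mul_div_cancel₀, hn.ne']

theorem mul_liCoeff_cons {a : F} (ha : a ≠ 0) (w : List F) (n : ℕ) :
    n * liCoeff (a :: w) n = -∑ m ∈ Finset.range n, liCoeff w m * a⁻¹ ^ (n - m) := by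
  rcases Nat.eq_zero_or_pos n with rfl | hn
  · simp
  · simp [liCoeff, ha, mul_div_cancel₀, hn.ne']

theorem liCoeff_recurrence {a : F} {w : List F} (h : w = [] → a ≠ 0) (n : ℕ) :
    n * liCoeff (a :: w) n - a * ((n + 1 : ℕ) * liCoeff (a :: w) (n + 1)) = liCoeff w n := by
  by_cases ha : a = 0
  · subst ha
    rw [mul_liCoeff_zero_cons fun hw => h hw rfl]
    ring
  · rw [mul_liCoeff_cons ha, mul_liCoeff_cons ha, sum_range_mul_pow_succ_sub]
    field_simp
    ring

theorem sub_mul_derivative_liSeries {a : F} {w : List F} (h : w = [] → a ≠ 0) :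
    (X - C a) * derivative F (liSeries (a :: w)) = liSeries w := by
  ext n
  have coeff_X_mul : coeff n (X * derivative F (liSeries (a :: w))) = n * liCoeff (a :: w) n := by
    cases n with
    | zero => simp
    | succ n => simp [coeff_succ_X_mul, coeff_derivative, liSeries, mul_comm]
  rw [sub_mul, map_sub, coeff_C_mul, coeff_derivative, coeff_X_mul]
  simp only [liSeries, coeff_mk, ← liCoeff_recurrence h n]
  push_cast
  ring

theorem sub_mul_derivative_shuffleSum {a : F} {u v : List F}
    (h : ∀ w ∈ shuffles u v, w = [] → a ≠ 0) :
    (X - C a) * derivative F (shuffleSum (fun w => liSeries (a :: w)) u v) =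
      shuffleSum liSeries u v := by
  rw [map_shuffleSum, ← AddMonoidHom.coe_mulLeft, map_shuffleSum]
  exact shuffleSum_congr fun w hw => sub_mul_derivative_liSeries (h w hw)

/-- Both sides of the shuffle product formula have the same constant term, and by induction also the
same derivative. -/
theorem liSeries_mul {u v : List F} (hu : Admissible u) (hv : Admissible v) :
    liSeries u * liSeries v = shuffleSum liSeries u v := by
  induction u, v using shuffles.induct with
  | case1 v => rw [shuffleSum_nil_left, liSeries_nil, one_mul]
  | case2 a u => rw [shuffleSum_nil_right, liSeries_nil, mul_one]
  | case3 a u b v ih₁ ih₂ =>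
    have X_sub_C_ne_zero (c : F) : (X - C c : PowerSeries F) ≠ 0 := fun h => by
      simpa using congrArg (coeff 1) h
    have nil_not_mem {u v : List F} (h : (u ++ v).length ≠ 0) : ∀ w ∈ shuffles u v, w ≠ [] := by
      rintro w hw rfl
      exact h (perm_append_of_mem_shuffles hw).length_eq.symm
    refine derivative.ext (mul_left_cancel₀
      (mul_ne_zero (X_sub_C_ne_zero a) (X_sub_C_ne_zero b)) ?_) ?_
    · rw [shuffleSum_cons_cons, map_add, mul_add, Derivation.leibniz, smul_eq_mul, smul_eq_mul]
      have deriv_shuffle_left := sub_mul_derivative_shuffleSum (a := a) (u := u) (v := b :: v)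
        fun w hw hnil => absurd hnil (nil_not_mem (by simp) w hw)
      have deriv_shuffle_right := sub_mul_derivative_shuffleSum (a := b) (u := a :: u) (v := v)
        fun w hw hnil => absurd hnil (nil_not_mem (by simp) w hw)
      rw [← ih₁ hu.2 hv] at deriv_shuffle_left
      rw [← ih₂ hu hv.2] at deriv_shuffle_right
      linear_combination (X - C a) * liSeries (a :: u) * sub_mul_derivative_liSeries hv.1
        + (X - C b) * liSeries (b :: v) * sub_mul_derivative_liSeries hu.1
        - (X - C b) * deriv_shuffle_left - (X - C a) * deriv_shuffle_right
    · simp only [shuffleSum_cons_cons, map_add, map_mul, map_shuffleSum,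
        constantCoeff_liSeries_cons, shuffleSum_zero, mul_zero, add_zero]

end TaylorSeries

/-! ### Growth of the Taylor coefficients -/

theorem sum_range_inv_sqrt_succ_le (n : ℕ) :
    ∑ m ∈ Finset.range n, 1 / √((m : ℝ) + 1) ≤ 2 * √(n : ℝ) := by
  induction n with
  | zero => simp
  | succ n ih =>
    rw [Finset.sum_range_succ]
    push_cast
    have sq_sqrt_succ : √((n : ℝ) + 1) ^ 2 = n + 1 := Real.sq_sqrt (by positivity)
    have sq_sqrt : √(n : ℝ) ^ 2 = n := Real.sq_sqrt (by positivity)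
    have inv_sqrt_le : 1 / √((n : ℝ) + 1) ≤ 2 * √((n : ℝ) + 1) - 2 * √(n : ℝ) := by
      rw [div_le_iff₀ (by positivity)]
      nlinarith [sq_nonneg (√((n : ℝ) + 1) - √(n : ℝ))]
    linarith

theorem norm_sum_mul_pow_sub_div_le {c : ℕ → ℂ} {C : ℝ} {y : ℂ}
    (hc : ∀ n : ℕ, ‖c n‖ ≤ C / √(n + 1)) (hy : ‖y‖ ≤ 1) (n : ℕ) :
    ‖(∑ m ∈ Finset.range n, c m * y ^ (n - m)) / n‖ ≤ 4 * C / √(n + 1) := by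
  have hC : 0 ≤ C := by simpa using (norm_nonneg _).trans (hc 0)
  rcases Nat.eq_zero_or_pos n with rfl | hn
  · simpa using hC
  have norm_sum_le_sqrt : ‖∑ m ∈ Finset.range n, c m * y ^ (n - m)‖ ≤ C * (2 * √(n : ℝ)) := by
    calc ‖∑ m ∈ Finset.range n, c m * y ^ (n - m)‖
        ≤ ∑ m ∈ Finset.range n, C * (1 / √((m : ℝ) + 1)) := norm_sum_le_of_le _ fun m _ => by
          rw [norm_mul, norm_pow, mul_one_div]
          exact (mul_le_of_le_one_right (norm_nonneg _) (pow_le_one₀ (norm_nonneg y) hy)).trans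
            (hc m)
      _ ≤ C * (2 * √(n : ℝ)) := by
          rw [← Finset.mul_sum]
          exact mul_le_mul_of_nonneg_left (sum_range_inv_sqrt_succ_le n) hC
  have one_le : (1 : ℝ) ≤ n := by exact_mod_cast hn
  have sq_sqrt_succ : √((n : ℝ) + 1) ^ 2 = n + 1 := Real.sq_sqrt (by positivity)
  have sq_sqrt : √(n : ℝ) ^ 2 = n := Real.sq_sqrt (by positivity)
  have sqrt_mul_sqrt_le : √(n : ℝ) * √((n : ℝ) + 1) ≤ 2 * n := by
    nlinarith [sq_nonneg (√((n : ℝ) + 1) - √(n : ℝ))]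
  rw [norm_div, Complex.norm_natCast, div_le_div_iff₀ (by linarith) (by positivity)]
  calc _ ≤ C * (2 * √(n : ℝ)) * √((n : ℝ) + 1) := by gcongr
    _ ≤ 4 * C * n := by nlinarith

theorem exists_norm_liCoeff_le {w : List ℂ} (hw : ∀ a ∈ w, ‖a⁻¹‖ ≤ 1) :
    ∃ C : ℝ, ∀ n : ℕ, ‖liCoeff w n‖ ≤ C / √(n + 1) := by
  induction w with
  | nil =>
    refine ⟨1, fun n => ?_⟩
    rcases Nat.eq_zero_or_pos n with rfl | hn
    · simp [liCoeff]
    · simp [liCoeff, hn.ne']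
  | cons a w ih =>
    rw [List.forall_mem_cons] at hw
    obtain ⟨C, hC⟩ := ih hw.2
    by_cases ha : a = 0
    · refine ⟨C, fun n => le_trans ?_ (hC n)⟩
      rw [liCoeff, if_pos ha, norm_div, Complex.norm_natCast]
      cases n with
      | zero => simp
      | succ n => exact div_le_self (norm_nonneg _) (by simp)
    · refine ⟨4 * C, fun n => ?_⟩
      rw [liCoeff, if_neg ha, neg_div, norm_neg]
      exact norm_sum_mul_pow_sub_div_le hC hw.1 n

theorem exists_norm_liCoeff_le_const {w : List ℂ} (hw : ∀ a ∈ w, ‖a⁻¹‖ ≤ 1) :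
    ∃ C : ℝ, ∀ n, ‖liCoeff w n‖ ≤ C := by
  obtain ⟨C, hC⟩ := exists_norm_liCoeff_le hw
  refine ⟨C, fun n => (hC n).trans (div_le_self ?_ (Real.one_le_sqrt.2 (by simp)))⟩
  simpa using (norm_nonneg _).trans (hC 0)

theorem tendsto_liCoeff {w : List ℂ} (hw : ∀ a ∈ w, ‖a⁻¹‖ ≤ 1) :
    Tendsto (liCoeff w) atTop (𝓝 0) := by
  obtain ⟨C, hC⟩ := exists_norm_liCoeff_le hw
  refine squeeze_zero_norm hC (Tendsto.const_div_atTop (Real.tendsto_sqrt_atTop.comp ?_) C)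
  exact tendsto_atTop_add_const_right _ _ tendsto_natCast_atTop_atTop

theorem summable_liCoeff_div_succ {w : List ℂ} (hw : ∀ a ∈ w, ‖a⁻¹‖ ≤ 1) :
    Summable fun n : ℕ => liCoeff w n / (n + 1 : ℕ) := by
  obtain ⟨C, hC⟩ := exists_norm_liCoeff_le hw
  have summable_rpow : Summable fun n : ℕ => 1 / ((n + 1 : ℕ) : ℝ) ^ (3 / 2 : ℝ) :=
    (summable_nat_add_iff 1).2 (Real.summable_one_div_nat_rpow.2 (by norm_num))
  refine Summable.of_norm_bounded (summable_rpow.mul_left C) fun n => ?_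
  have succ_pos : (0 : ℝ) < (n + 1 : ℕ) := by positivity
  rw [norm_div, Complex.norm_natCast, mul_one_div, show (3 / 2 : ℝ) = 1 / 2 + 1 by norm_num,
    Real.rpow_add succ_pos, Real.rpow_one, ← Real.sqrt_eq_rpow, ← div_div]
  gcongr
  exact_mod_cast hC n

theorem exists_tendsto_sum_of_summable_sub_mul {K : Type*} [Field K] [TopologicalSpace K]
    [IsTopologicalRing K] {g : ℕ → K} {a : K} (ha : a ≠ 1) (hg : Tendsto g atTop (𝓝 0))
    (hsum : Summable fun n => g n - a * g (n + 1)) :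
    ∃ L, Tendsto (fun M => ∑ n ∈ Finset.range M, g n) atTop (𝓝 L) := by
  have abel (M : ℕ) : (∑ n ∈ Finset.range M, (g n - a * g (n + 1))) + a * (g M - g 0) =
      (1 - a) * ∑ n ∈ Finset.range M, g n := by
    have shift := (Finset.sum_range_succ g M).symm.trans (Finset.sum_range_succ' g M)
    rw [Finset.sum_sub_distrib, ← Finset.mul_sum]
    linear_combination a * shift
  refine ⟨_, (((hsum.hasSum.tendsto_sum_nat.add
    ((hg.sub_const (g 0)).const_mul a)).const_mul (1 - a)⁻¹).congr fun M => ?_)⟩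
  rw [abel, inv_mul_cancel_left₀ (sub_ne_zero.2 ha.symm)]

theorem exists_tendsto_sum_liCoeff {w : List ℂ} (hadm : Admissible w) (hw : ∀ a ∈ w, ‖a⁻¹‖ ≤ 1)
    (h1 : w.head? ≠ some 1) :
    ∃ L, Tendsto (fun M => ∑ n ∈ Finset.range M, liCoeff w n) atTop (𝓝 L) := by
  cases w with
  | nil =>
    refine ⟨1, tendsto_const_nhds.congr' ?_⟩
    filter_upwards [eventually_gt_atTop 0] with M hM
    simp [liCoeff, hM]
  | cons a w =>
    refine exists_tendsto_sum_of_summable_sub_mul (a := a) (by simpa using h1)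
      (tendsto_liCoeff hw) (((summable_liCoeff_div_succ fun b hb => hw b
        (List.mem_cons_of_mem a hb)).add (summable_liCoeff_div_succ hw)).congr fun n => ?_)
    rw [← liCoeff_recurrence hadm.1]
    push_cast
    field_simp [Nat.cast_add_one_ne_zero n]
    ring

/-! ### Sums of Taylor series in the unit disc -/

theorem summable_norm_mul_pow_of_bounded {c : ℕ → ℂ} {C : ℝ} (hc : ∀ n, ‖c n‖ ≤ C) {z : ℂ}
    (hz : ‖z‖ < 1) : Summable fun n => ‖c n * z ^ n‖ := by
  refine ((summable_geometric_of_lt_one (norm_nonneg z) hz).mul_left C).of_nonneg_of_le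
    (fun n => norm_nonneg _) fun n => ?_
  rw [norm_mul, norm_pow]
  exact mul_le_mul_of_nonneg_right (hc n) (by positivity)

theorem summable_natCast_mul_pow_pred {ρ : ℝ} (hρ₀ : 0 < ρ) (hρ₁ : ρ < 1) :
    Summable fun n : ℕ => n * ρ ^ (n - 1) := by
  refine ((summable_pow_mul_geometric_of_norm_lt_one 1
    (by rwa [Real.norm_of_nonneg hρ₀.le])).mul_left ρ⁻¹).congr fun n => ?_
  cases n with
  | zero => simp
  | succ n =>
    rw [Nat.add_sub_cancel, pow_one, pow_succ]
    field_simp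

theorem hasDerivAt_tsum_mul_pow {c : ℕ → ℂ} {C : ℝ} (hc : ∀ n, ‖c n‖ ≤ C) {z : ℂ}
    (hz : ‖z‖ < 1) :
    HasDerivAt (fun y => ∑' n, c n * y ^ n) (∑' n : ℕ, c n * (n * z ^ (n - 1))) z ∧
      Summable fun n : ℕ => c n * (n * z ^ (n - 1)) := by
  obtain ⟨ρ, hzρ, hρ⟩ := exists_between hz
  have summable_bound : Summable fun n : ℕ => C * (n * ρ ^ (n - 1)) :=
    (summable_natCast_mul_pow_pred ((norm_nonneg z).trans_lt hzρ) hρ).mul_left C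
  have norm_deriv_le (n : ℕ) (y : ℂ) (hy : y ∈ Metric.ball (0 : ℂ) ρ) :
      ‖c n * (n * y ^ (n - 1))‖ ≤ C * (n * ρ ^ (n - 1)) := by
    rw [norm_mul, norm_mul, norm_pow, Complex.norm_natCast]
    gcongr
    · exact (norm_nonneg _).trans (hc n)
    · exact hc n
    · exact (mem_ball_zero_iff.1 hy).le
  have hzball : z ∈ Metric.ball (0 : ℂ) ρ := mem_ball_zero_iff.2 hzρ
  exact ⟨hasDerivAt_tsum_of_isPreconnected summable_bound Metric.isOpen_ball
    (convex_ball (0 : ℂ) ρ).isPreconnected (fun n y _ => (hasDerivAt_pow n y).const_mul _)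
    norm_deriv_le hzball (summable_norm_mul_pow_of_bounded hc hz).of_norm hzball,
    Summable.of_norm_bounded summable_bound fun n => norm_deriv_le n z hzball⟩

/-- The sum of the Taylor series `liSeries w` in the unit disc, where it is the iterated integral of
`w` along the segment from `0` to `z`. -/
def liFun (w : List ℂ) (z : ℂ) : ℂ := ∑' n, liCoeff w n * z ^ n

theorem liFun_nil (z : ℂ) : liFun [] z = 1 := by
  rw [liFun, tsum_eq_single 0 fun n hn => by simp [liCoeff, hn]]
  simp [liCoeff]

theorem liFun_cons_zero (a : ℂ) (w : List ℂ) : liFun (a :: w) 0 = 0 := by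
  rw [liFun, tsum_eq_single 0 fun n hn => by simp [hn]]
  simp [liCoeff_cons_zero]

theorem summable_norm_liCoeff {w : List ℂ} (hw : ∀ a ∈ w, ‖a⁻¹‖ ≤ 1) {z : ℂ} (hz : ‖z‖ < 1) :
    Summable fun n => ‖liCoeff w n * z ^ n‖ :=
  (exists_norm_liCoeff_le_const hw).elim fun _ hC => summable_norm_mul_pow_of_bounded hC hz

theorem liFun_differentiableAt {w : List ℂ} (hw : ∀ a ∈ w, ‖a⁻¹‖ ≤ 1) {z : ℂ} (hz : ‖z‖ < 1) :
    DifferentiableAt ℂ (liFun w) z :=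
  (exists_norm_liCoeff_le_const hw).elim fun _ hC =>
    (hasDerivAt_tsum_mul_pow hC hz).1.differentiableAt

theorem liFun_hasDerivAt {a : ℂ} {w : List ℂ} (h : w = [] → a ≠ 0)
    (hw : ∀ b ∈ a :: w, ‖b⁻¹‖ ≤ 1) {z : ℂ} (hz : ‖z‖ < 1) (hza : z ≠ a) :
    HasDerivAt (liFun (a :: w)) (liFun w z / (z - a)) z := by
  obtain ⟨C, hC⟩ := exists_norm_liCoeff_le_const hw
  obtain ⟨hderiv, hsum⟩ := hasDerivAt_tsum_mul_pow hC hz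
  refine HasDerivAt.congr_deriv hderiv (Eq.symm ?_)
  have hsum_succ : Summable fun n : ℕ => liCoeff (a :: w) (n + 1) * ((n + 1 : ℕ) * z ^ n) :=
    ((summable_nat_add_iff 1).2 hsum).congr fun n => by simp
  have tsum_shift : ∑' n : ℕ, liCoeff (a :: w) n * (n * z ^ (n - 1)) =
      ∑' n : ℕ, liCoeff (a :: w) (n + 1) * ((n + 1 : ℕ) * z ^ n) := by
    simp [hsum.tsum_eq_zero_add]
  rw [div_eq_iff (sub_ne_zero.2 hza), mul_sub, mul_comm, mul_comm _ a]
  nth_rw 2 [tsum_shift]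
  rw [← tsum_mul_left, ← tsum_mul_left, ← (hsum.mul_left z).tsum_sub (hsum_succ.mul_left a), liFun]
  refine tsum_congr fun n => ?_
  rw [← liCoeff_recurrence h n]
  cases n with
  | zero => simp
  | succ n =>
    rw [Nat.add_sub_cancel]
    ring

theorem liFun_mul {u v : List ℂ} (hu : Admissible u) (hv : Admissible v)
    (hu' : ∀ a ∈ u, ‖a⁻¹‖ ≤ 1) (hv' : ∀ a ∈ v, ‖a⁻¹‖ ≤ 1) {z : ℂ} (hz : ‖z‖ < 1) :
    liFun u z * liFun v z = shuffleSum (fun w => liFun w z) u v := by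
  have hasSum_shuffle : HasSum (fun n => shuffleSum (fun w => liCoeff w n * z ^ n) u v)
      (shuffleSum (fun w => liFun w z) u v) :=
    hasSum_shuffleSum fun w hw =>
      (summable_norm_liCoeff (forall_mem_of_mem_shuffles hu' hv' hw) hz).of_norm.hasSum
  rw [← hasSum_shuffle.tsum_eq, liFun, liFun,
    tsum_mul_tsum_eq_tsum_sum_antidiagonal_of_summable_norm
      (summable_norm_liCoeff hu' hz) (summable_norm_liCoeff hv' hz)]
  refine tsum_congr fun n => ?_
  have coeff_mul := congrArg (PowerSeries.coeff n) (liSeries_mul hu hv)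
  rw [PowerSeries.coeff_mul, map_shuffleSum] at coeff_mul
  simp only [liSeries, PowerSeries.coeff_mk] at coeff_mul
  refine Eq.trans ?_ (map_shuffleSum (AddMonoidHom.mulRight (z ^ n)) (liCoeff · n) u v)
  rw [AddMonoidHom.mulRight_apply, ← coeff_mul, Finset.sum_mul]
  refine Finset.sum_congr rfl fun p hp => ?_
  rw [← Finset.HasAntidiagonal.mem_antidiagonal.1 hp, pow_add]
  ring

open Set Asymptotics

/-! ### Iterated integrals starting at a positive point

In the hypothesis `‖a⁻¹‖ ≤ 1` on a letter, the convention `0⁻¹ = 0` lets `a = 0` pass. -/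

theorem ofReal_ne_of_norm_inv_le_one {a : ℂ} (ha : ‖a⁻¹‖ ≤ 1) {t : ℝ} (ht : t ∈ Ioo (0 : ℝ) 1) :
    (t : ℂ) ≠ a := by
  rintro rfl
  rw [norm_inv, Complex.norm_real, Real.norm_of_nonneg ht.1.le] at ha
  exact ha.not_gt ((one_lt_inv₀ ht.1).2 ht.2)

theorem one_div_norm_ofReal_sub_le {a : ℂ} (ha : ‖a⁻¹‖ ≤ 1) {t : ℝ} (ht : t ∈ Ioo (0 : ℝ) 1) :
    1 / ‖(t : ℂ) - a‖ ≤ 1 / t + 1 / (1 - t) := by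
  have one_sub_pos : 0 < 1 - t := sub_pos.2 ht.2
  have norm_t : ‖(t : ℂ)‖ = t := by rw [Complex.norm_real, Real.norm_of_nonneg ht.1.le]
  by_cases h0 : a = 0
  · rw [h0, sub_zero, norm_t]
    exact le_add_of_nonneg_right (by positivity)
  · have one_le_norm : 1 ≤ ‖a‖ := by
      rwa [norm_inv, inv_le_one₀ (norm_pos_iff.2 h0)] at ha
    have one_sub_le_norm : 1 - t ≤ ‖(t : ℂ) - a‖ := by
      have := norm_sub_norm_le a (t : ℂ)
      rw [norm_t, norm_sub_rev] at this
      linarith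
    exact (one_div_le_one_div_of_le one_sub_pos one_sub_le_norm).trans
      (le_add_of_nonneg_left (one_div_nonneg.2 ht.1.le))

theorem liFun_hasDerivAt_ofReal {a : ℂ} {w : List ℂ} (h : w = [] → a ≠ 0)
    (hw : ∀ b ∈ a :: w, ‖b⁻¹‖ ≤ 1) {t : ℝ} (ht : t ∈ Ioo (0 : ℝ) 1) :
    HasDerivAt (fun s : ℝ => liFun (a :: w) s) (liFun w t / (t - a)) t :=
  (liFun_hasDerivAt h hw (by rw [Complex.norm_real, Real.norm_of_nonneg ht.1.le]; exact ht.2)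
    (ofReal_ne_of_norm_inv_le_one (hw a List.mem_cons_self) ht)).comp_ofReal

theorem liFun_cons_isBigO {a : ℂ} {w : List ℂ} (hw : ∀ b ∈ a :: w, ‖b⁻¹‖ ≤ 1) :
    (fun z : ℝ => liFun (a :: w) z) =O[𝓝 0] fun z => z := by
  have hdiff := liFun_differentiableAt hw (z := ((0 : ℝ) : ℂ)) (by simp)
  simpa [liFun_cons_zero] using hdiff.hasDerivAt.comp_ofReal.isBigO_sub

theorem iterIntRev_cons_hasDerivAt {a : ℂ} {w : List ℂ} {p : ℝ} (hp : p ∈ Ioo (0 : ℝ) 1)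
    (hw : ContinuousOn (iterIntRev w p) (Ioo 0 1)) (ha : ‖a⁻¹‖ ≤ 1) {t : ℝ}
    (ht : t ∈ Ioo (0 : ℝ) 1) :
    HasDerivAt (iterIntRev (a :: w) p) (iterIntRev w p t / (t - a)) t := by
  have hcont : ContinuousOn (fun s : ℝ => iterIntRev w p s / ((s : ℂ) - a)) (Ioo 0 1) :=
    hw.div (by fun_prop) fun s hs => sub_ne_zero.2 (ofReal_ne_of_norm_inv_le_one ha hs)
  exact intervalIntegral.integral_hasDerivAt_right
    (hcont.mono (ordConnected_Ioo.uIcc_subset hp ht)).intervalIntegrable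
    (hcont.stronglyMeasurableAtFilter isOpen_Ioo t ht)
    (hcont.continuousAt (Ioo_mem_nhds ht.1 ht.2))

theorem iterIntRev_continuousOn {w : List ℂ} (hw : ∀ a ∈ w, ‖a⁻¹‖ ≤ 1) {p : ℝ}
    (hp : p ∈ Ioo (0 : ℝ) 1) : ContinuousOn (iterIntRev w p) (Ioo 0 1) := by
  induction w with
  | nil => exact continuousOn_const
  | cons a w ih =>
    rw [List.forall_mem_cons] at hw
    exact fun t ht =>
      (iterIntRev_cons_hasDerivAt hp (ih hw.2) hw.1 ht).continuousAt.continuousWithinAt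

theorem norm_sub_le_neg_log_of_norm_deriv_le {F F' : ℝ → ℂ} {z M : ℝ} (hz : 0 < z)
    (hF : ∀ x ∈ Icc z (1 - z), HasDerivAt F (F' x) x)
    (hF' : ∀ x ∈ Icc z (1 - z), ‖F' x‖ ≤ M * (1 / x + 1 / (1 - x))) {t : ℝ}
    (ht : t ∈ Icc z (1 - z)) : ‖F t - F z‖ ≤ 2 * M * -Real.log z := by
  have mem_Ioo (x : ℝ) (hx : x ∈ Icc z (1 - z)) : 0 < x ∧ 0 < 1 - x :=
    ⟨hz.trans_le hx.1, by linarith [hx.2]⟩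
  have hM : 0 ≤ M := by
    obtain ⟨ht₀, ht₁⟩ := mem_Ioo t ht
    exact nonneg_of_mul_nonneg_left ((norm_nonneg _).trans (hF' t ht)) (by positivity)
  let B (x : ℝ) : ℝ := M * (Real.log x - Real.log (1 - x) - (Real.log z - Real.log (1 - z)))
  have hasDerivAt_B (x : ℝ) (hx : x ∈ Icc z (1 - z)) :
      HasDerivAt B (M * (1 / x + 1 / (1 - x))) x := by
    have deriv_log := Real.hasDerivAt_log (mem_Ioo x hx).1.ne'
    have deriv_log_sub := ((hasDerivAt_id x).const_sub 1).log (mem_Ioo x hx).2.ne'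
    refine (((deriv_log.sub deriv_log_sub).sub_const _).const_mul M).congr_deriv ?_
    simp only [id_eq]
    ring
  have norm_sub_le : ‖F t - F z‖ ≤ B t :=
    image_norm_le_of_norm_deriv_right_le_deriv_boundary' (f := fun x => F x - F z)
      (fun x hx => ((hF x hx).sub_const _).continuousAt.continuousWithinAt)
      (fun x hx => ((hF x (Ico_subset_Icc_self hx)).sub_const _).hasDerivWithinAt)
      (by simp [B]) (fun x hx => (hasDerivAt_B x hx).continuousAt.continuousWithinAt)
      (fun x hx => (hasDerivAt_B x (Ico_subset_Icc_self hx)).hasDerivWithinAt)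
      (fun x hx => hF' x (Ico_subset_Icc_self hx)) ht
  have log_t : Real.log t ≤ 0 :=
    Real.log_nonpos (mem_Ioo t ht).1.le (by linarith [(mem_Ioo t ht).2])
  have log_one_sub_t : Real.log z ≤ Real.log (1 - t) := Real.log_le_log hz (by linarith [ht.2])
  have log_one_sub_z : Real.log (1 - z) ≤ 0 :=
    Real.log_nonpos (by linarith [ht.1, (mem_Ioo t ht).2]) (by linarith)
  calc ‖F t - F z‖ ≤ B t := norm_sub_le
    _ ≤ M * (2 * -Real.log z) := mul_le_mul_of_nonneg_left (by linarith) hM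
    _ = 2 * M * -Real.log z := by ring

theorem norm_iterIntRev_cons_sub_liFun_le {a : ℂ} {w : List ℂ} (h : w = [] → a ≠ 0)
    (hw : ∀ b ∈ a :: w, ‖b⁻¹‖ ≤ 1) {z M : ℝ} (hz₀ : 0 < z)
    (hM : ∀ t ∈ Icc z (1 - z), ‖iterIntRev w z t - liFun w t‖ ≤ M) {t : ℝ}
    (ht : t ∈ Icc z (1 - z)) :
    ‖iterIntRev (a :: w) z t - liFun (a :: w) t‖ ≤
      ‖liFun (a :: w) z‖ + 2 * M * -Real.log z := by
  have mem_Ioo (x : ℝ) (hx : x ∈ Icc z (1 - z)) : x ∈ Ioo (0 : ℝ) 1 :=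
    ⟨hz₀.trans_le hx.1, by linarith [hx.2]⟩
  have hz : z ∈ Ioo (0 : ℝ) 1 := mem_Ioo z ⟨le_rfl, ht.1.trans ht.2⟩
  have hderiv (x : ℝ) (hx : x ∈ Icc z (1 - z)) :
      HasDerivAt (fun s : ℝ => iterIntRev (a :: w) z s - liFun (a :: w) s)
        ((iterIntRev w z x - liFun w x) / (x - a)) x := by
    rw [sub_div]
    exact (iterIntRev_cons_hasDerivAt hz
      (iterIntRev_continuousOn (List.forall_mem_cons.1 hw).2 hz) (hw a List.mem_cons_self)
      (mem_Ioo x hx)).sub (liFun_hasDerivAt_ofReal h hw (mem_Ioo x hx))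
  have norm_deriv_le (x : ℝ) (hx : x ∈ Icc z (1 - z)) :
      ‖(iterIntRev w z x - liFun w x) / ((x : ℂ) - a)‖ ≤ M * (1 / x + 1 / (1 - x)) := by
    rw [norm_div, div_eq_mul_one_div]
    exact mul_le_mul (hM x hx) (one_div_norm_ofReal_sub_le (hw a List.mem_cons_self)
      (mem_Ioo x hx)) (by positivity) ((norm_nonneg _).trans (hM x hx))
  refine (norm_le_norm_add_norm_sub' _ _).trans (add_le_add (le_of_eq ?_)
    (norm_sub_le_neg_log_of_norm_deriv_le hz₀ hderiv norm_deriv_le ht))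
  rw [iterIntRev, intervalIntegral.integral_same, zero_sub, norm_neg]

theorem norm_iterIntRev_sub_liFun_le {w : List ℂ} (hadm : Admissible w)
    (hw : ∀ a ∈ w, ‖a⁻¹‖ ≤ 1) :
    ∃ C : ℝ, ∀ᶠ z : ℝ in 𝓝[>] 0, ∀ t ∈ Icc z (1 - z),
      ‖iterIntRev w z t - liFun w t‖ ≤ C * (z * (1 - Real.log z) ^ w.length) := by
  induction w with
  | nil => exact ⟨0, by simp [iterIntRev, liFun_nil]⟩
  | cons a w ih =>
    obtain ⟨C, hC⟩ := ih hadm.2 (List.forall_mem_cons.1 hw).2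
    obtain ⟨C₀, hC₀, hstart⟩ := (liFun_cons_isBigO hw).exists_nonneg
    refine ⟨2 * C + C₀, ?_⟩
    filter_upwards [hC, nhdsWithin_le_nhds hstart.bound, Ioo_mem_nhdsGT one_pos]
      with z hz norm_start ⟨hz₀, hz₁⟩ t ht
    rw [Real.norm_of_nonneg hz₀.le] at norm_start
    have log_neg : Real.log z < 0 := Real.log_neg hz₀ hz₁
    have one_le : 1 ≤ (1 - Real.log z) ^ (w.length + 1) := one_le_pow₀ (by linarith)
    set M := C * (z * (1 - Real.log z) ^ w.length) with hM
    have hM₀ : 0 ≤ M := (norm_nonneg _).trans (hz t ht)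
    calc ‖iterIntRev (a :: w) z t - liFun (a :: w) t‖
        ≤ ‖liFun (a :: w) z‖ + 2 * M * -Real.log z :=
          norm_iterIntRev_cons_sub_liFun_le hadm.1 hw hz₀ hz ht
      _ ≤ C₀ * (z * (1 - Real.log z) ^ (w.length + 1)) + 2 * M * (1 - Real.log z) := by
          gcongr
          · exact norm_start.trans
              (mul_le_mul_of_nonneg_left (le_mul_of_one_le_right hz₀.le one_le) hC₀)
          · linarith
      _ = (2 * C + C₀) * (z * (1 - Real.log z) ^ (a :: w).length) := by
          rw [hM, List.length_cons, pow_succ]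
          ring

/-! ### Polynomials in the logarithm -/

theorem polynomial_log_isLittleO_rpow (P : Polynomial ℂ) {r : ℝ} (hr : r < 0) :
    (fun s : ℝ => P.eval ((Real.log s : ℝ) : ℂ)) =o[𝓝[>] 0] fun s : ℝ => s ^ r := by
  induction P using Polynomial.induction_on' with
  | add p q hp hq => simpa using hp.add hq
  | monomial n a =>
    simp only [Polynomial.eval_monomial]
    refine IsLittleO.const_mul_left (IsLittleO.of_norm_left ?_) a
    refine (isLittleO_abs_log_rpow_rpow_nhdsGT_zero n hr).congr_left fun s => ?_
    rw [Real.rpow_natCast, norm_pow, Complex.norm_real, Real.norm_eq_abs]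

theorem polynomial_log_isLittleO_inv_sqrt (P : Polynomial ℂ) :
    (fun s : ℝ => P.eval ((Real.log s : ℝ) : ℂ)) =o[𝓝[>] 0] fun s : ℝ => (√s)⁻¹ := by
  refine (polynomial_log_isLittleO_rpow P (r := -(1 / 2)) (by norm_num)).congr'
    EventuallyEq.rfl ?_
  filter_upwards [self_mem_nhdsWithin] with s hs
  rw [Real.rpow_neg (le_of_lt hs), ← Real.sqrt_eq_rpow]

theorem tendsto_mul_norm_polynomial_log (P : Polynomial ℂ) :
    Tendsto (fun s : ℝ => s * ‖P.eval ((Real.log s : ℝ) : ℂ)‖) (𝓝[>] 0) (𝓝 0) := by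
  have hlittle := polynomial_log_isLittleO_rpow P (r := -1) (by norm_num)
  refine hlittle.norm_left.tendsto_div_nhds_zero.congr fun s => ?_
  rw [Real.rpow_neg_one, div_inv_eq_mul, mul_comm]

theorem polynomial_eq_zero_of_tendsto_log {P : Polynomial ℂ}
    (h : Tendsto (fun z : ℝ => P.eval ((Real.log z : ℝ) : ℂ)) (𝓝[>] 0) (𝓝 0)) : P = 0 := by
  by_cases hd : 0 < P.degree
  · have norm_log_atTop : Tendsto (fun z : ℝ => ‖((Real.log z : ℝ) : ℂ)‖) (𝓝[>] 0) atTop := by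
      simp only [Complex.norm_real]
      exact tendsto_abs_atBot_atTop.comp Real.tendsto_log_nhdsGT_zero
    exact absurd (P.tendsto_norm_atTop hd norm_log_atTop) (not_tendsto_atTop_of_tendsto_nhds h.norm)
  · rw [Polynomial.eq_C_of_degree_le_zero (not_lt.1 hd)] at h ⊢
    simp only [Polynomial.eval_C] at h
    rw [tendsto_nhds_unique tendsto_const_nhds h, Polynomial.C_0]

theorem exists_polynomial_derivative_eq {K : Type*} [Field K] [CharZero K] (P : Polynomial K) :
    ∃ Q : Polynomial K, Polynomial.derivative Q = P := by
  induction P using Polynomial.induction_on' with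
  | add p q hp hq =>
    obtain ⟨p', rfl⟩ := hp
    obtain ⟨q', rfl⟩ := hq
    exact ⟨p' + q', Polynomial.derivative_add⟩
  | monomial n a =>
    refine ⟨Polynomial.monomial (n + 1) (a / (n + 1)), ?_⟩
    rw [Polynomial.derivative_monomial, Nat.add_sub_cancel, Nat.cast_succ,
      div_mul_cancel₀ _ (Nat.cast_add_one_ne_zero n)]

theorem tendsto_iterIntRev_sub_liFun {w : List ℂ} (hadm : Admissible w)
    (hw : ∀ a ∈ w, ‖a⁻¹‖ ≤ 1) :
    Tendsto (fun z : ℝ => iterIntRev w z (1 - z) - liFun w ((1 - z : ℝ) : ℂ))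
      (𝓝[>] 0) (𝓝 0) := by
  obtain ⟨C, hC⟩ := norm_iterIntRev_sub_liFun_le hadm hw
  have bound_tendsto := (tendsto_mul_norm_polynomial_log
    ((1 - Polynomial.X) ^ w.length)).const_mul C
  rw [mul_zero] at bound_tendsto
  refine squeeze_zero_norm' ?_ bound_tendsto
  filter_upwards [hC, Ioo_mem_nhdsGT one_half_pos] with z hz ⟨hz₀, hz₁⟩
  have log_neg : Real.log z < 0 := Real.log_neg hz₀ (by linarith)
  have norm_one_sub_log : ‖1 - ((Real.log z : ℝ) : ℂ)‖ = 1 - Real.log z := by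
    rw [← Complex.ofReal_one, ← Complex.ofReal_sub, Complex.norm_real,
      Real.norm_of_nonneg (by linarith)]
  simpa [norm_one_sub_log] using hz (1 - z) ⟨by linarith, le_rfl⟩

/-! ### Logarithmic asymptotics at `1` -/

/-- A function on `(0, 1)` equals a polynomial in `log (1 - t)` up to `O(√(1 - t))` as `t → 1`.
Any exponent in `(0, 1)` in place of `1 / 2` would give a class stable under the integrations
below. -/
def HasLogAsymptotics (f : ℝ → ℂ) (P : Polynomial ℂ) : Prop :=
  (fun s : ℝ => f (1 - s) - P.eval ((Real.log s : ℝ) : ℂ)) =O[𝓝[>] 0] fun s : ℝ => √s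

theorem tendsto_sqrt_nhdsGT_zero : Tendsto (fun s : ℝ => √s) (𝓝[>] 0) (𝓝 0) := by
  simpa using (Real.continuous_sqrt.tendsto 0).mono_left nhdsWithin_le_nhds

/-- The substitution `s = u ^ 2` turns `k` into a Lipschitz function of `u`, which extends to
`u = 0`. -/
theorem exists_sub_isBigO_sqrt_of_deriv_isBigO {E : Type*} [NormedAddCommGroup E]
    [NormedSpace ℝ E] [FiniteDimensional ℝ E] {k k' : ℝ → E}
    (hk : ∀ s ∈ Ioo (0 : ℝ) 1, HasDerivAt k (k' s) s)
    (hk' : k' =O[𝓝[>] 0] fun s : ℝ => (√s)⁻¹) :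
    ∃ L, (fun s => k s - L) =O[𝓝[>] 0] fun s : ℝ => √s := by
  obtain ⟨C, hC, hbound⟩ := hk'.exists_nonneg
  obtain ⟨δ, hδ, hsub⟩ := mem_nhdsGT_iff_exists_Ioo_subset.1
    (inter_mem hbound.bound (Ioo_mem_nhdsGT one_pos))
  have sq_mem (u : ℝ) (hu : u ∈ Ioo 0 √δ) : u ^ 2 ∈ Ioo 0 δ :=
    ⟨pow_pos hu.1 2, (Real.lt_sqrt hu.1.le).1 hu.2⟩
  have hderiv (u : ℝ) (hu : u ∈ Ioo 0 √δ) :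
      HasDerivAt (fun u => k (u ^ 2)) ((2 * u) • k' (u ^ 2)) u := by
    simpa [Function.comp_def] using
      (hk _ (hsub (sq_mem u hu)).2).scomp (h := fun u : ℝ => u ^ 2) u (hasDerivAt_pow 2 u)
  have norm_deriv_le (u : ℝ) (hu : u ∈ Ioo 0 √δ) :
      ‖(2 * u) • k' (u ^ 2)‖₊ ≤ (2 * C).toNNReal := by
    have norm_k'_le : ‖k' (u ^ 2)‖ ≤ C * u⁻¹ := by
      simpa [Real.sqrt_sq hu.1.le, abs_of_pos hu.1] using (hsub (sq_mem u hu)).1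
    rw [← NNReal.coe_le_coe, coe_nnnorm, Real.coe_toNNReal _ (by positivity), norm_smul,
      Real.norm_of_nonneg (by linarith [hu.1])]
    calc 2 * u * ‖k' (u ^ 2)‖ ≤ 2 * u * (C * u⁻¹) := by
          have := hu.1
          gcongr
      _ = 2 * C := by
          have := hu.1.ne'
          field_simp
  obtain ⟨g, hg, heq⟩ := ((convex_Ioo 0 √δ).lipschitzOnWith_of_nnnorm_hasDerivWithin_le
    (fun u hu => (hderiv u hu).hasDerivWithinAt) norm_deriv_le).extend_finite_dimension
  refine ⟨g 0, IsBigO.of_bound (lipschitzExtensionConstant E * (2 * C).toNNReal : NNReal) ?_⟩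
  filter_upwards [Ioo_mem_nhdsGT hδ] with s hs
  have k_eq : k s = g √s := by
    simpa [Real.sq_sqrt hs.1.le] using
      heq ⟨Real.sqrt_pos.2 hs.1, Real.sqrt_lt_sqrt hs.1.le hs.2⟩
  simpa [k_eq] using hg.norm_sub_le √s 0

namespace HasLogAsymptotics

variable {f g : ℝ → ℂ} {P Q : Polynomial ℂ}

theorem tendsto (hf : HasLogAsymptotics f P) :
    Tendsto (fun s : ℝ => f (1 - s) - P.eval ((Real.log s : ℝ) : ℂ)) (𝓝[>] 0) (𝓝 0) :=
  hf.trans_tendsto tendsto_sqrt_nhdsGT_zero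

theorem isBigO_inv_sqrt (hf : HasLogAsymptotics f P) :
    (fun s : ℝ => f (1 - s)) =O[𝓝[>] 0] fun s : ℝ => (√s)⁻¹ := by
  have sqrt_isBigO : (fun s : ℝ => √s) =O[𝓝[>] 0] fun s : ℝ => (√s)⁻¹ := by
    refine IsBigO.of_bound' ?_
    filter_upwards [Ioo_mem_nhdsGT one_pos] with s hs
    have sqrt_le_one : √s ≤ 1 := Real.sqrt_le_one.2 hs.2.le
    rw [Real.norm_of_nonneg (Real.sqrt_nonneg s), Real.norm_of_nonneg (by positivity)]
    exact sqrt_le_one.trans ((one_le_inv₀ (Real.sqrt_pos.2 hs.1)).2 sqrt_le_one)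
  exact ((hf.trans sqrt_isBigO).add (polynomial_log_isLittleO_inv_sqrt P).isBigO).congr_left
    fun s => sub_add_cancel _ _

theorem exists_of_hasDerivAt_div_sub_one (hf : HasLogAsymptotics f P)
    (hg : ∀ t ∈ Ioo (0 : ℝ) 1, HasDerivAt g (f t / (t - 1)) t) :
    ∃ Q, HasLogAsymptotics g Q := by
  obtain ⟨Q, hQ⟩ := exists_polynomial_derivative_eq P
  have hderiv (s : ℝ) (hs : s ∈ Ioo (0 : ℝ) 1) :
      HasDerivAt (fun s => g (1 - s) - Q.eval ((Real.log s : ℝ) : ℂ))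
        ((f (1 - s) - P.eval ((Real.log s : ℝ) : ℂ)) * ((s⁻¹ : ℝ) : ℂ)) s := by
    have deriv_log := (Q.hasDerivAt ((Real.log s : ℝ) : ℂ)).comp s
      (Real.hasDerivAt_log hs.1.ne').ofReal_comp
    have deriv_g := (hg (1 - s) ⟨by linarith [hs.2], by linarith [hs.1]⟩).comp_const_sub 1 s
    rw [hQ] at deriv_log
    refine (deriv_g.sub deriv_log).congr_deriv ?_
    push_cast
    rw [show (1 : ℂ) - s - 1 = -s by ring, div_neg, neg_neg]
    ring
  have hbound : (fun s => (f (1 - s) - P.eval ((Real.log s : ℝ) : ℂ)) * ((s⁻¹ : ℝ) : ℂ))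
      =O[𝓝[>] 0] fun s : ℝ => (√s)⁻¹ := by
    have inv_isBigO : (fun s : ℝ => ((s⁻¹ : ℝ) : ℂ)) =O[𝓝[>] 0] fun s : ℝ => s⁻¹ :=
      isBigO_of_le _ fun s => (Complex.norm_real _).le
    refine (hf.mul inv_isBigO).congr_right fun s => ?_
    rw [← div_eq_mul_inv, Real.sqrt_div_self]
  obtain ⟨L, hL⟩ := exists_sub_isBigO_sqrt_of_deriv_isBigO hderiv hbound
  refine ⟨Q + Polynomial.C L, hL.congr_left fun s => ?_⟩
  rw [Polynomial.eval_add, Polynomial.eval_C, sub_sub]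

theorem exists_of_hasDerivAt_div_sub_of_ne_one {a : ℂ} (ha : a ≠ 1) (hf : HasLogAsymptotics f P)
    (hg : ∀ t ∈ Ioo (0 : ℝ) 1, HasDerivAt g (f t / (t - a)) t) :
    ∃ Q, HasLogAsymptotics g Q := by
  have hderiv (s : ℝ) (hs : s ∈ Ioo (0 : ℝ) 1) :
      HasDerivAt (fun s => g (1 - s)) (-(f (1 - s) / ((1 - s : ℝ) - a))) s :=
    (hg (1 - s) ⟨by linarith [hs.2], by linarith [hs.1]⟩).comp_const_sub 1 s
  have inv_isBigO : (fun s : ℝ => (((1 - s : ℝ) : ℂ) - a)⁻¹) =O[𝓝[>] 0] fun _ => (1 : ℝ) := by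
    have hcont : ContinuousAt (fun s : ℝ => (((1 - s : ℝ) : ℂ) - a)⁻¹) 0 :=
      ContinuousAt.inv₀ (by fun_prop) (by simpa [sub_eq_zero] using ha.symm)
    exact (hcont.tendsto.mono_left nhdsWithin_le_nhds).isBigO_one ℝ
  obtain ⟨L, hL⟩ := exists_sub_isBigO_sqrt_of_deriv_isBigO hderiv
    (by simpa [div_eq_mul_inv] using (hf.isBigO_inv_sqrt.mul inv_isBigO).neg_left)
  exact ⟨Polynomial.C L, by simpa [HasLogAsymptotics] using hL⟩

theorem tendsto_sub_mul_polynomial_log (hf : HasLogAsymptotics f P) (Q : Polynomial ℂ) :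
    Tendsto (fun s : ℝ => (f (1 - s) - P.eval ((Real.log s : ℝ) : ℂ)) *
      Q.eval ((Real.log s : ℝ) : ℂ)) (𝓝[>] 0) (𝓝 0) := by
  have hlittle := hf.mul_isLittleO (polynomial_log_isLittleO_inv_sqrt Q)
  refine (isLittleO_one_iff ℝ).1 (hlittle.congr' EventuallyEq.rfl ?_)
  filter_upwards [self_mem_nhdsWithin] with s hs
  exact mul_inv_cancel₀ (Real.sqrt_pos.2 hs).ne'

theorem tendsto_mul (hf : HasLogAsymptotics f P) (hg : HasLogAsymptotics g Q) :
    Tendsto (fun s : ℝ => f (1 - s) * g (1 - s) - (P * Q).eval ((Real.log s : ℝ) : ℂ))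
      (𝓝[>] 0) (𝓝 0) := by
  have hsum := ((hf.tendsto.mul hg.tendsto).add (hf.tendsto_sub_mul_polynomial_log Q)).add
    (hg.tendsto_sub_mul_polynomial_log P)
  rw [mul_zero, add_zero, add_zero] at hsum
  refine hsum.congr fun s => ?_
  rw [Polynomial.eval_mul]
  ring

end HasLogAsymptotics

theorem exists_hasLogAsymptotics_liFun {w : List ℂ} (hadm : Admissible w)
    (hw : ∀ a ∈ w, ‖a⁻¹‖ ≤ 1) : ∃ P, HasLogAsymptotics (fun t => liFun w t) P := by
  induction w with
  | nil => exact ⟨1, by simpa [HasLogAsymptotics, liFun_nil] using isBigO_zero _ _⟩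
  | cons a w ih =>
    obtain ⟨P, hP⟩ := ih hadm.2 (List.forall_mem_cons.1 hw).2
    have hderiv (t : ℝ) (ht : t ∈ Ioo (0 : ℝ) 1) := liFun_hasDerivAt_ofReal hadm.1 hw ht
    by_cases ha : a = 1
    · subst ha
      exact hP.exists_of_hasDerivAt_div_sub_one hderiv
    · exact hP.exists_of_hasDerivAt_div_sub_of_ne_one ha hderiv

/-! ### Regularized values -/

/-- `regInt` for words written with the letter of the largest variable first. -/
def regIntRev (w : List ℂ) : ℂ := regInt w.reverse

theorem IsLogExpansion.unique {w : List ℂ} {P Q : Polynomial ℂ} (hP : IsLogExpansion w P)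
    (hQ : IsLogExpansion w Q) : P = Q := by
  refine sub_eq_zero.1 (polynomial_eq_zero_of_tendsto_log ?_)
  simpa using Tendsto.sub hQ hP

theorem IsLogExpansion.regInt_eq {w : List ℂ} {P : Polynomial ℂ} (h : IsLogExpansion w P) :
    regInt w = P.coeff 0 := by
  have hex : ∃ P, IsLogExpansion w P := ⟨P, h⟩
  rw [regInt, dif_pos hex, hex.choose_spec.unique h]

theorem regIntRev_eq_of_tendsto {w : List ℂ} (hadm : Admissible w) (hw : ∀ a ∈ w, ‖a⁻¹‖ ≤ 1)
    {P : Polynomial ℂ} (hP : Tendsto (fun s : ℝ => liFun w ((1 - s : ℝ) : ℂ) -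
      P.eval ((Real.log s : ℝ) : ℂ)) (𝓝[>] 0) (𝓝 0)) : regIntRev w = P.coeff 0 := by
  refine IsLogExpansion.regInt_eq ?_
  simpa [IsLogExpansion, iterInt] using (tendsto_iterIntRev_sub_liFun hadm hw).add hP

theorem mul_eq_shuffleSum_of_hasLogAsymptotics {u v : List ℂ} (hu : Admissible u)
    (hv : Admissible v) (hu' : ∀ a ∈ u, ‖a⁻¹‖ ≤ 1) (hv' : ∀ a ∈ v, ‖a⁻¹‖ ≤ 1)
    {P Q : Polynomial ℂ} {R : List ℂ → Polynomial ℂ}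
    (hP : HasLogAsymptotics (fun t => liFun u t) P) (hQ : HasLogAsymptotics (fun t => liFun v t) Q)
    (hR : ∀ w ∈ shuffles u v, HasLogAsymptotics (fun t => liFun w t) (R w)) :
    P * Q = shuffleSum R u v := by
  refine sub_eq_zero.1 (polynomial_eq_zero_of_tendsto_log ?_)
  have hsub := (tendsto_shuffleSum fun w hw => (hR w hw).tendsto).sub (hP.tendsto_mul hQ)
  rw [shuffleSum_zero, sub_zero] at hsub
  refine hsub.congr' ?_
  filter_upwards [Ioo_mem_nhdsGT one_pos] with s hs
  have norm_lt : ‖((1 - s : ℝ) : ℂ)‖ < 1 := by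
    rw [Complex.norm_real, Real.norm_of_nonneg (by linarith [hs.2])]
    linarith [hs.1]
  have eval_shuffleSum := map_shuffleSum (Polynomial.evalRingHom ((Real.log s : ℝ) : ℂ)) R u v
  simp only [Polynomial.coe_evalRingHom] at eval_shuffleSum
  rw [shuffleSum_sub, liFun_mul hu hv hu' hv' norm_lt, Polynomial.eval_sub, eval_shuffleSum]
  ring

theorem regIntRev_mul {u v : List ℂ} (hu : Admissible u) (hv : Admissible v)
    (hu' : ∀ a ∈ u, ‖a⁻¹‖ ≤ 1) (hv' : ∀ a ∈ v, ‖a⁻¹‖ ≤ 1) :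
    regIntRev u * regIntRev v = shuffleSum regIntRev u v := by
  have exists_asymptotics (w : List ℂ) (hw : Admissible w ∧ ∀ a ∈ w, ‖a⁻¹‖ ≤ 1) :
      ∃ P, HasLogAsymptotics (fun t => liFun w t) P := exists_hasLogAsymptotics_liFun hw.1 hw.2
  choose! P hP using exists_asymptotics
  have shuffle_good (w : List ℂ) (hw : w ∈ shuffles u v) :
      Admissible w ∧ ∀ a ∈ w, ‖a⁻¹‖ ≤ 1 :=
    ⟨hu.of_mem_shuffles hv hw, forall_mem_of_mem_shuffles hu' hv' hw⟩
  have regIntRev_eq (w : List ℂ) (hw : Admissible w ∧ ∀ a ∈ w, ‖a⁻¹‖ ≤ 1) :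
      regIntRev w = (P w).coeff 0 := regIntRev_eq_of_tendsto hw.1 hw.2 (hP w hw).tendsto
  have coeff_shuffleSum := map_shuffleSum (Polynomial.lcoeff ℂ 0) P u v
  simp only [Polynomial.lcoeff_apply] at coeff_shuffleSum
  rw [regIntRev_eq u ⟨hu, hu'⟩, regIntRev_eq v ⟨hv, hv'⟩, ← Polynomial.mul_coeff_zero,
    mul_eq_shuffleSum_of_hasLogAsymptotics hu hv hu' hv' (hP u ⟨hu, hu'⟩) (hP v ⟨hv, hv'⟩)
      fun w hw => hP w (shuffle_good w hw), coeff_shuffleSum]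
  exact shuffleSum_congr fun w hw => (regIntRev_eq w (shuffle_good w hw)).symm

theorem tendsto_one_sub_nhdsGT_zero : Tendsto (fun s : ℝ => 1 - s) (𝓝[>] 0) (𝓝[<] 1) := by
  refine tendsto_nhdsWithin_of_tendsto_nhds_of_eventually_within _ ?_ ?_
  · have hcont : Continuous fun s : ℝ => 1 - s := by fun_prop
    simpa using (hcont.tendsto 0).mono_left nhdsWithin_le_nhds
  · filter_upwards [self_mem_nhdsWithin] with s hs using sub_lt_self 1 (mem_Ioi.1 hs)

theorem tendsto_sum_liCoeff {w : List ℂ} (hadm : Admissible w) (hw : ∀ a ∈ w, ‖a⁻¹‖ ≤ 1)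
    (h1 : w.head? ≠ some 1) :
    Tendsto (fun M => ∑ n ∈ Finset.range M, liCoeff w n) atTop (𝓝 (regIntRev w)) := by
  obtain ⟨L, hL⟩ := exists_tendsto_sum_liCoeff hadm hw h1
  have abel : Tendsto (fun s : ℝ => liFun w ((1 - s : ℝ) : ℂ)) (𝓝[>] 0) (𝓝 L) :=
    (tendsto_map'_iff.1 (Complex.tendsto_tsum_powerSeries_nhdsWithin_lt hL)).comp
      tendsto_one_sub_nhdsGT_zero
  have regIntRev_eq : regIntRev w = L := by
    rw [regIntRev_eq_of_tendsto hadm hw (P := Polynomial.C L)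
      (by simpa using abel.sub_const L), Polynomial.coeff_C_zero]
  rwa [regIntRev_eq]

/-! ### Sums over increasing tuples -/

/-- The increasing tuples of `s` positive integers with largest entry `m`. -/
def incTuplesTop (s m : ℕ) : Finset (Fin s → ℕ) := (incTuples s (m + 1)).filter (top · = m)

theorem mem_incTuples {s M : ℕ} (hM : 0 < M) {n : Fin s → ℕ} :
    n ∈ incTuples s M ↔ (StrictMono n ∧ ∀ j, 1 ≤ n j) ∧ top n < M := by
  rw [incTuples, Finset.mem_filter, Fintype.mem_piFinset, top,
    Finset.sup_lt_iff (by simpa using hM)]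
  simp only [Finset.mem_Ico, Finset.mem_univ, true_imp_iff, forall_and]
  tauto

theorem mem_incTuplesTop {s m : ℕ} {n : Fin s → ℕ} :
    n ∈ incTuplesTop s m ↔ (StrictMono n ∧ ∀ j, 1 ≤ n j) ∧ top n = m := by
  rw [incTuplesTop, Finset.mem_filter, mem_incTuples (Nat.succ_pos m)]
  exact ⟨fun h => ⟨h.1.1, h.2⟩, fun h => ⟨⟨h.1, h.2.trans_lt (Nat.lt_succ_self m)⟩, h.2⟩⟩

theorem incTuplesTop_zero (m : ℕ) : incTuplesTop 0 m = if m = 0 then Finset.univ else ∅ := by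
  ext n
  split_ifs with hm <;>
    simp [mem_incTuplesTop, top, Subsingleton.strictMono, eq_comm, hm, eq_iff_true_of_subsingleton]

theorem top_eq_last {s : ℕ} {n : Fin (s + 1) → ℕ} (h : StrictMono n) : top n = n (Fin.last s) :=
  le_antisymm (Finset.sup_le fun j _ => h.monotone (Fin.le_last j))
    (Finset.le_sup (Finset.mem_univ _))

theorem strictMono_snoc {s m : ℕ} {n : Fin s → ℕ} (h : StrictMono n) (hm : ∀ j, n j < m) :
    StrictMono (Fin.snoc n m : Fin (s + 1) → ℕ) := by
  intro i j hij
  obtain ⟨i, rfl⟩ := Fin.exists_castSucc_eq.2 (hij.trans_le (Fin.le_last j)).ne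
  induction j using Fin.lastCases with
  | last => simpa using hm i
  | cast j => simpa using h (Fin.castSucc_lt_castSucc_iff.1 hij)

theorem snoc_mem_incTuplesTop {s m : ℕ} (hm : 0 < m) {n : Fin s → ℕ} (hn : n ∈ incTuples s m) :
    (Fin.snoc n m : Fin (s + 1) → ℕ) ∈ incTuplesTop (s + 1) m := by
  obtain ⟨⟨hmono, hpos⟩, htop⟩ := (mem_incTuples hm).1 hn
  have snoc_mono := strictMono_snoc hmono fun j =>
    (Finset.le_sup (f := n) (Finset.mem_univ j)).trans_lt htop
  refine mem_incTuplesTop.2 ⟨⟨snoc_mono, ?_⟩, by rw [top_eq_last snoc_mono, Fin.snoc_last]⟩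
  exact Fin.lastCases (by simpa using Nat.succ_le_of_lt hm) fun j => by simpa using hpos j

theorem init_mem_incTuples {s m : ℕ} {n : Fin (s + 1) → ℕ} (hn : n ∈ incTuplesTop (s + 1) m) :
    (Fin.init n : Fin s → ℕ) ∈ incTuples s m := by
  obtain ⟨⟨hmono, hpos⟩, htop⟩ := mem_incTuplesTop.1 hn
  rw [top_eq_last hmono] at htop
  have hm : 0 < m := htop ▸ hpos (Fin.last s)
  refine (mem_incTuples hm).2 ⟨⟨fun i j hij => hmono (Fin.castSucc_lt_castSucc_iff.2 hij),
    fun j => hpos _⟩, (Finset.sup_lt_iff hm).2 fun j _ => ?_⟩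
  exact htop ▸ hmono (Fin.castSucc_lt_last j)

section

variable {E : Type*} [AddCommMonoid E]

theorem sum_incTuples_eq {s m : ℕ} (hm : 0 < m) (f : (Fin s → ℕ) → E) :
    ∑ n ∈ incTuples s m, f n = ∑ i ∈ Finset.range m, ∑ n ∈ incTuplesTop s i, f n := by
  rw [← Finset.sum_fiberwise_of_maps_to (g := top) fun n hn =>
    Finset.mem_range.2 ((mem_incTuples hm).1 hn).2]
  refine Finset.sum_congr rfl fun i hi => Finset.sum_congr ?_ fun _ _ => rfl
  ext n
  rw [Finset.mem_filter, mem_incTuples hm, mem_incTuplesTop, and_assoc]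
  exact and_congr_right fun _ => and_iff_right_of_imp fun h => h ▸ Finset.mem_range.1 hi

theorem sum_incTuplesTop_succ {s m : ℕ} (f : (Fin (s + 1) → ℕ) → E) :
    ∑ n ∈ incTuplesTop (s + 1) m, f n =
      ∑ i ∈ Finset.range m, ∑ n ∈ incTuplesTop s i, f (Fin.snoc n m) := by
  rcases Nat.eq_zero_or_pos m with rfl | hm
  · refine Finset.sum_eq_zero fun n hn => ?_
    obtain ⟨⟨hmono, hpos⟩, htop⟩ := mem_incTuplesTop.1 hn
    exact absurd (hpos (Fin.last s)) (by simp [← top_eq_last hmono, htop])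
  · rw [← sum_incTuples_eq hm]
    have snoc_init (n : Fin (s + 1) → ℕ) (hn : n ∈ incTuplesTop (s + 1) m) :
        (Fin.snoc (Fin.init n) m : Fin (s + 1) → ℕ) = n := by
      obtain ⟨⟨hmono, -⟩, rfl⟩ := mem_incTuplesTop.1 hn
      rw [top_eq_last hmono, Fin.snoc_init_self]
    exact Finset.sum_bij' (fun n _ => Fin.init n) (fun n _ => Fin.snoc n m)
      (fun _ => init_mem_incTuples) (fun _ => snoc_mem_incTuplesTop hm) snoc_init
      (fun _ _ => Fin.init_snoc _ _) fun n hn => by rw [snoc_init n hn]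

theorem sum_incTuples_product_eq {a b M : ℕ} (f : (Fin a → ℕ) × (Fin b → ℕ) → E) :
    ∑ p ∈ (incTuples a M ×ˢ incTuples b M).filter (fun p => top p.1 + top p.2 < M), f p =
      ∑ n ∈ Finset.range M, ∑ q ∈ Finset.HasAntidiagonal.antidiagonal n,
        ∑ p ∈ incTuplesTop a q.1 ×ˢ incTuplesTop b q.2, f p := by
  rw [Finset.sum_sigma', ← Finset.sum_fiberwise_of_maps_to
    (t := (Finset.range M).sigma fun n => Finset.HasAntidiagonal.antidiagonal n)
    (g := fun p : (Fin a → ℕ) × (Fin b → ℕ) =>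
      (⟨top p.1 + top p.2, (top p.1, top p.2)⟩ : Σ _ : ℕ, ℕ × ℕ)) fun p hp => by
        simpa using (Finset.mem_filter.1 hp).2]
  refine Finset.sum_congr rfl fun ⟨n, i, j⟩ hq => Finset.sum_congr ?_ fun _ _ => rfl
  obtain ⟨hn, rfl⟩ : n < M ∧ i + j = n := by simpa using hq
  have hM : 0 < M := by omega
  ext p
  simp only [Finset.mem_filter, Finset.mem_product, mem_incTuples hM, mem_incTuplesTop,
    Sigma.mk.injEq, heq_eq_eq, Prod.mk.injEq]
  constructor
  · rintro ⟨⟨⟨⟨h₁, -⟩, h₂, -⟩, -⟩, -, h₃, h₄⟩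
    exact ⟨⟨h₁, h₃⟩, h₂, h₄⟩
  · rintro ⟨⟨h₁, rfl⟩, h₂, rfl⟩
    exact ⟨⟨⟨⟨h₁, by omega⟩, h₂, by omega⟩, hn⟩, rfl, rfl, rfl⟩

end

theorem prevEntry_castSucc {s : ℕ} (n : Fin (s + 1) → ℕ) (j : Fin s) :
    prevEntry n j.castSucc = prevEntry (Fin.init n) j := by
  simp [prevEntry, Fin.init]

theorem prevEntry_snoc_last {s : ℕ} {n : Fin s → ℕ} (h : StrictMono n) (m : ℕ) :
    prevEntry (Fin.snoc n m : Fin (s + 1) → ℕ) (Fin.last s) = top n := by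
  cases s with
  | zero => simp [prevEntry, top]
  | succ s =>
    rw [top_eq_last h]
    simp only [prevEntry, Fin.val_last, Nat.succ_pos, if_true]
    exact Fin.snoc_castSucc (α := fun _ => ℕ) m n (Fin.last s)

theorem liTerm_snoc {s : ℕ} (x : Fin (s + 1) → ℂ) (k : Fin (s + 1) → ℕ) {n : Fin s → ℕ}
    (h : StrictMono n) (m : ℕ) :
    liTerm x k (Fin.snoc n m) = liTerm (Fin.init x) (Fin.init k) n *
      (x (Fin.last s) ^ (m - top n) / (m : ℂ) ^ k (Fin.last s)) := by
  rw [liTerm, Fin.prod_univ_castSucc, prevEntry_snoc_last h, liTerm]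
  simp only [prevEntry_castSucc, Fin.snoc_castSucc, Fin.snoc_last, Fin.init_snoc, Fin.init]

/-! ### Words and multiple `L`-values -/

/-- `word x k`, with the letter of the largest variable first. -/
def revWord {s : ℕ} (x : Fin s → ℂ) (k : Fin s → ℕ) : List ℂ := (word x k).reverse

theorem revWord_zero (x : Fin 0 → ℂ) (k : Fin 0 → ℕ) : revWord x k = [] := by
  simp [revWord, word]

theorem revWord_succ {s : ℕ} (x : Fin (s + 1) → ℂ) (k : Fin (s + 1) → ℕ) :
    revWord x k = List.replicate (k (Fin.last s) - 1) 0 ++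
      (x (Fin.last s))⁻¹ :: revWord (Fin.init x) (Fin.init k) := by
  simp only [revWord, word]
  rw [List.ofFn_succ', List.concat_eq_append, List.flatten_append, List.reverse_append]
  simp [Fin.init_def]

theorem forall_mem_revWord {s : ℕ} {x : Fin s → ℂ} {p : ℂ → Prop} (hx : ∀ j, p (x j)⁻¹)
    (h0 : p 0) (k : Fin s → ℕ) : ∀ a ∈ revWord x k, p a := by
  simp only [revWord, word, List.mem_reverse, List.mem_flatten, List.mem_ofFn]
  rintro a ⟨-, ⟨j, rfl⟩, ha⟩
  rcases List.mem_cons.1 ha with rfl | ha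
  · exact hx j
  · exact (List.eq_of_mem_replicate ha) ▸ h0

theorem norm_inv_le_one_of_mem_revWord {s : ℕ} {x : Fin s → ℂ} (hx : ∀ j, ‖x j‖ ≤ 1)
    (k : Fin s → ℕ) : ∀ a ∈ revWord x k, ‖a⁻¹‖ ≤ 1 :=
  forall_mem_revWord (by simpa using hx) (by simp) k

theorem Admissible.replicate_append {A : Type*} [Zero A] (j : ℕ) {w : List A} (h : Admissible w)
    (hw : w ≠ []) : Admissible (List.replicate j 0 ++ w) := by
  induction j with
  | zero => exact h
  | succ j ih => exact ⟨fun hnil => absurd (List.append_eq_nil_iff.1 hnil).2 hw, ih⟩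

theorem admissible_revWord {s : ℕ} {x : Fin s → ℂ} (hx : ∀ j, x j ≠ 0) (k : Fin s → ℕ) :
    Admissible (revWord x k) := by
  induction s with
  | zero => rw [revWord_zero]; trivial
  | succ s ih =>
    rw [revWord_succ]
    exact Admissible.replicate_append _
      ⟨fun _ => inv_ne_zero (hx _), ih (fun j => hx j.castSucc) _⟩ (List.cons_ne_nil _ _)

theorem liCoeff_replicate_append {F : Type*} [Field F] (j : ℕ) (w : List F) (m : ℕ) :
    liCoeff (List.replicate j 0 ++ w) m = liCoeff w m / (m : F) ^ j := by
  induction j with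
  | zero => simp
  | succ j ih =>
    rw [List.replicate_succ, List.cons_append, liCoeff, if_pos rfl, ih, pow_succ, div_div]

theorem sum_liTerm_incTuplesTop {s : ℕ} {x : Fin s → ℂ} {k : Fin s → ℕ} (hx : ∀ j, x j ≠ 0)
    (hk : ∀ j, 1 ≤ k j) (m : ℕ) :
    ∑ n ∈ incTuplesTop s m, liTerm x k n = (-1) ^ s * liCoeff (revWord x k) m := by
  induction s generalizing m with
  | zero =>
    rw [incTuplesTop_zero, revWord_zero, liCoeff]
    split_ifs <;> simp [liTerm]
  | succ s ih =>
    have inner_sum (i : ℕ) : ∑ n ∈ incTuplesTop s i, liTerm x k (Fin.snoc n m) =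
        (-1) ^ s * liCoeff (revWord (Fin.init x) (Fin.init k)) i *
          (x (Fin.last s) ^ (m - i) / (m : ℂ) ^ k (Fin.last s)) := by
      rw [← ih (x := Fin.init x) (k := Fin.init k) (fun _ => hx _) (fun _ => hk _), Finset.sum_mul]
      refine Finset.sum_congr rfl fun n hn => ?_
      obtain ⟨⟨hmono, -⟩, rfl⟩ := mem_incTuplesTop.1 hn
      exact liTerm_snoc x k hmono m
    rw [sum_incTuplesTop_succ, Finset.sum_congr rfl fun i _ => inner_sum i, revWord_succ,
      liCoeff_replicate_append, liCoeff, if_neg (inv_ne_zero (hx _)), inv_inv, div_div,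
      ← pow_succ', Nat.sub_add_cancel (hk _), neg_div, Finset.sum_div, mul_neg, Finset.mul_sum,
      ← Finset.sum_neg_distrib]
    refine Finset.sum_congr rfl fun i _ => ?_
    rw [pow_succ]
    ring

theorem liProdTrunc_eq {a b : ℕ} (M : ℕ) {x : Fin a → ℂ} {k : Fin a → ℕ} {y : Fin b → ℂ}
    {l : Fin b → ℕ} (hx : ∀ j, x j ≠ 0) (hk : ∀ j, 1 ≤ k j) (hy : ∀ j, y j ≠ 0)
    (hl : ∀ j, 1 ≤ l j) :
    liProdTrunc M x k y l = (-1) ^ (a + b) * ∑ n ∈ Finset.range M,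
      PowerSeries.coeff n (liSeries (revWord x k) * liSeries (revWord y l)) := by
  simp only [liProdTrunc, sum_incTuples_product_eq, Finset.sum_product, ← Finset.sum_mul_sum,
    sum_liTerm_incTuplesTop hx hk, sum_liTerm_incTuplesTop hy hl, PowerSeries.coeff_mul, liSeries,
    PowerSeries.coeff_mk, Finset.mul_sum, pow_add]
  exact Finset.sum_congr rfl fun n _ => Finset.sum_congr rfl fun q _ => by ring

theorem Lsh_eq {s : ℕ} (x : Fin s → ℂ) (k : Fin s → ℕ) :
    Lsh x k = (-1) ^ s * regIntRev (revWord x k) := by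
  rw [Lsh, regIntRev, revWord, List.reverse_reverse]

theorem Lsh_mul_Lsh {a b : ℕ} {x : Fin a → ℂ} (hx : ∀ j, x j ≠ 0 ∧ ‖x j‖ ≤ 1) (k : Fin a → ℕ)
    {y : Fin b → ℂ} (hy : ∀ j, y j ≠ 0 ∧ ‖y j‖ ≤ 1) (l : Fin b → ℕ) :
    Lsh x k * Lsh y l = (-1) ^ (a + b) * shuffleSum regIntRev (revWord x k) (revWord y l) := by
  rw [Lsh_eq, Lsh_eq, mul_mul_mul_comm, ← pow_add, regIntRev_mul
    (admissible_revWord (fun j => (hx j).1) k) (admissible_revWord (fun j => (hy j).1) l)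
    (norm_inv_le_one_of_mem_revWord (fun j => (hx j).2) k)
    (norm_inv_le_one_of_mem_revWord (fun j => (hy j).2) l)]

theorem exists_eq_revWord {w : List ℂ} (h : Admissible w) {X : Set ℂ}
    (hX : ∀ a ∈ w, a = 0 ∨ a⁻¹ ∈ X) : ∃ (s : ℕ) (ξ : Fin s → ℂ) (l : Fin s → ℕ),
      (∀ j, ξ j ∈ X) ∧ (∀ j, 1 ≤ l j) ∧ w = revWord ξ l := by
  induction w with
  | nil => exact ⟨0, Fin.elim0, Fin.elim0, Fin.rec0, Fin.rec0, (revWord_zero _ _).symm⟩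
  | cons a w ih =>
    obtain ⟨s, ξ, l, hξ, hl, rfl⟩ := ih h.2 (List.forall_mem_cons.1 hX).2
    rcases hX a List.mem_cons_self with rfl | ha
    · cases s with
      | zero => exact absurd rfl (h.1 (revWord_zero _ _))
      | succ s =>
        refine ⟨s + 1, ξ, Fin.snoc (Fin.init l) (l (Fin.last s) + 1), hξ,
          Fin.lastCases (by simp) fun j => by simpa [Fin.init] using hl j.castSucc, ?_⟩
        rw [revWord_succ, revWord_succ, Fin.snoc_last, Fin.init_snoc,
          Nat.sub_add_comm (hl (Fin.last s)), List.replicate_succ, List.cons_append]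
    · refine ⟨s + 1, Fin.snoc ξ a⁻¹, Fin.snoc l 1, Fin.lastCases (by simpa using ha)
        fun j => by simpa using hξ j, Fin.lastCases (by simp) fun j => by simpa using hl j, ?_⟩
      rw [revWord_succ]
      simp

/-- The `K`-span of the multiple `L`-values with arguments in `X`. -/
def lValueSpan (K : Subfield ℂ) (X : Set ℂ) : Submodule K ℂ :=
  Submodule.span K {c | ∃ (s : ℕ) (ξ : Fin s → ℂ) (l : Fin s → ℕ),
    (∀ j, ξ j ∈ X) ∧ (∀ j, 1 ≤ l j) ∧ c = Lsh ξ l}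

theorem neg_one_pow_mul_mem {R M : Type*} [Ring R] [SetLike M R] [NegMemClass M R] {S : M} {c : R}
    (s : ℕ) (hc : c ∈ S) : (-1) ^ s * c ∈ S := by
  rcases neg_one_pow_eq_or R s with h | h
  · rwa [h, one_mul]
  · rw [h, neg_one_mul]
    exact neg_mem hc

theorem regIntRev_mem_lValueSpan (K : Subfield ℂ) {X : Set ℂ} {w : List ℂ} (h : Admissible w)
    (hX : ∀ a ∈ w, a = 0 ∨ a⁻¹ ∈ X) : regIntRev w ∈ lValueSpan K X := by
  obtain ⟨s, ξ, l, hξ, hl, rfl⟩ := exists_eq_revWord h hX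
  have regIntRev_eq : regIntRev (revWord ξ l) = (-1) ^ s * Lsh ξ l := by
    rw [Lsh_eq, ← mul_assoc, ← mul_pow]
    simp
  rw [regIntRev_eq]
  exact neg_one_pow_mul_mem s (Submodule.subset_span ⟨s, ξ, l, hξ, hl, rfl⟩)

theorem Lsh_mul_Lsh_mem_lValueSpan (K : Subfield ℂ) {X : Set ℂ} (hX : ∀ z ∈ X, z ≠ 0 ∧ ‖z‖ ≤ 1)
    {a b : ℕ} {x : Fin a → ℂ} (hx : ∀ j, x j ∈ X) (k : Fin a → ℕ) {y : Fin b → ℂ}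
    (hy : ∀ j, y j ∈ X) (l : Fin b → ℕ) : Lsh x k * Lsh y l ∈ lValueSpan K X := by
  rw [Lsh_mul_Lsh (fun j => hX _ (hx j)) k (fun j => hX _ (hy j)) l]
  refine neg_one_pow_mul_mem _ (list_sum_mem ?_)
  simp only [List.forall_mem_map]
  intro w hw
  have letters_mem {s : ℕ} {z : Fin s → ℂ} (hz : ∀ j, z j ∈ X) (l : Fin s → ℕ) :
      ∀ a ∈ revWord z l, a = 0 ∨ a⁻¹ ∈ X :=
    forall_mem_revWord (by simp [hz]) (Or.inl rfl) l
  exact regIntRev_mem_lValueSpan K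
    ((admissible_revWord (fun j => (hX _ (hx j)).1) k).of_mem_shuffles
      (admissible_revWord (fun j => (hX _ (hy j)).1) l) hw)
    (forall_mem_of_mem_shuffles (letters_mem hx k) (letters_mem hy l) hw)

/-! ### The error of the partial sums -/

/-- The difference of the `M`-th partial sum of the Taylor series at `1` and the regularized
value. -/
def truncError (M : ℕ) (w : List ℂ) : ℂ :=
  (∑ n ∈ Finset.range M, liCoeff w n) - regIntRev w

/-- `truncError`, set to `0` on the words starting with the letter `1`, for which it may diverge as
`M → ∞`. -/
def convError (M : ℕ) (w : List ℂ) : ℂ := if w.head? = some 1 then 0 else truncError M w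

theorem truncError_eq (M : ℕ) (w : List ℂ) :
    truncError M w = onHead 1 (fun w => truncError M (1 :: w)) w + convError M w := by
  cases w with
  | nil => simp [onHead, convError]
  | cons a w => by_cases ha : a = 1 <;> simp [onHead_cons, convError, ha]

theorem shuffleSum_truncError (M : ℕ) (u v : List ℂ) :
    shuffleSum (truncError M) u v =
      shuffleSum (onHead 1 fun w => truncError M (1 :: w)) u v + shuffleSum (convError M) u v := by
  rw [← shuffleSum_add]
  exact shuffleSum_congr fun w _ => truncError_eq M w

theorem tendsto_convError {w : List ℂ} (hadm : Admissible w) (hw : ∀ a ∈ w, ‖a⁻¹‖ ≤ 1) :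
    Tendsto (fun M => convError M w) atTop (𝓝 0) := by
  by_cases h1 : w.head? = some 1
  · simp [convError, h1]
  · simpa [convError, h1, truncError] using
      (tendsto_sum_liCoeff hadm hw h1).sub_const (regIntRev w)

theorem tendsto_shuffleSum_convError {a b : ℕ} {x : Fin a → ℂ} (hx : ∀ j, x j ≠ 0 ∧ ‖x j‖ ≤ 1)
    (k : Fin a → ℕ) {y : Fin b → ℂ} (hy : ∀ j, y j ≠ 0 ∧ ‖y j‖ ≤ 1) (l : Fin b → ℕ) :
    Tendsto (fun M => shuffleSum (convError M) (revWord x k) (revWord y l)) atTop (𝓝 0) := by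
  rw [← shuffleSum_zero (revWord x k) (revWord y l)]
  exact tendsto_shuffleSum fun w hw => tendsto_convError
    ((admissible_revWord (fun j => (hx j).1) k).of_mem_shuffles
      (admissible_revWord (fun j => (hy j).1) l) hw)
    (forall_mem_of_mem_shuffles (norm_inv_le_one_of_mem_revWord (fun j => (hx j).2) k)
      (norm_inv_le_one_of_mem_revWord (fun j => (hy j).2) l) hw)

theorem liProdTrunc_sub_Lsh_mul_Lsh {a b : ℕ} (M : ℕ) {x : Fin a → ℂ}
    (hx : ∀ j, x j ≠ 0 ∧ ‖x j‖ ≤ 1) {k : Fin a → ℕ} (hk : ∀ j, 1 ≤ k j) {y : Fin b → ℂ}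
    (hy : ∀ j, y j ≠ 0 ∧ ‖y j‖ ≤ 1) {l : Fin b → ℕ} (hl : ∀ j, 1 ≤ l j) :
    liProdTrunc M x k y l - Lsh x k * Lsh y l =
      (-1) ^ (a + b) * shuffleSum (truncError M) (revWord x k) (revWord y l) := by
  rw [liProdTrunc_eq M (fun j => (hx j).1) hk (fun j => (hy j).1) hl, Lsh_mul_Lsh hx k hy l,
    liSeries_mul (admissible_revWord (fun j => (hx j).1) k)
      (admissible_revWord (fun j => (hy j).1) l), ← mul_sub]
  have sum_coeff_shuffleSum : ∑ n ∈ Finset.range M, PowerSeries.coeff n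
      (shuffleSum liSeries (revWord x k) (revWord y l)) =
        shuffleSum (fun w => ∑ n ∈ Finset.range M, liCoeff w n) (revWord x k) (revWord y l) := by
    rw [← LinearMap.sum_apply, map_shuffleSum]
    simp only [LinearMap.sum_apply, liSeries, PowerSeries.coeff_mk]
  rw [sum_coeff_shuffleSum, ← shuffleSum_sub]
  rfl

/-! ### Cancellation of the divergent parts -/

theorem onHead_one_revWord {s : ℕ} (x : Fin (s + 1) → ℂ) {k : Fin (s + 1) → ℕ}
    (hk : 1 ≤ k (Fin.last s)) (F : List ℂ → ℂ) :
    onHead 1 F (revWord x k) = if x (Fin.last s) = 1 ∧ k (Fin.last s) = 1 then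
      F (revWord (Fin.init x) (Fin.init k)) else 0 := by
  obtain ⟨m, hm⟩ := Nat.exists_eq_add_of_le' hk
  cases m with
  | zero => simp [revWord_succ, hm, onHead_cons]
  | succ m => simp [revWord_succ, hm, onHead_cons, List.replicate_succ]

theorem sum_piAntidiag_ite_last_eq_zero {E : Type*} [AddCommMonoid E] {s : ℕ} (d : ℕ)
    (g : (Fin s → ℕ) → E) :
    (∑ f ∈ Finset.piAntidiag (Finset.univ : Finset (Fin (s + 1))) d,
      if f (Fin.last s) = 0 then g (Fin.init f) else 0) =
      ∑ f ∈ Finset.piAntidiag (Finset.univ : Finset (Fin s)) d, g f := by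
  rw [← Finset.sum_filter]
  refine Finset.sum_bij' (fun f _ => Fin.init f) (fun f _ => Fin.snoc f 0) (fun f hf => ?_)
    (fun f hf => ?_) (fun f hf => ?_) (fun _ _ => Fin.init_snoc _ _) fun _ _ => rfl
  · obtain ⟨⟨hsum, -⟩, hlast⟩ := by simpa only [Finset.mem_filter, Finset.mem_piAntidiag] using hf
    rw [Fin.sum_univ_castSucc, hlast, add_zero] at hsum
    simpa [Finset.mem_piAntidiag, Fin.init_def] using hsum
  · simpa [Finset.mem_piAntidiag, Fin.sum_univ_castSucc] using hf
  · rw [← (Finset.mem_filter.1 hf).2, Fin.snoc_init_self]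

/-- The coefficient of `t ^ d` in the second factor of the symmetric construction, with the
`L`-value of a word `w` replaced by `F w`. -/
def rightSum {s : ℕ} (y : Fin s → ℂ) (l : Fin s → ℕ) (d : ℕ) (F : List ℂ → ℂ) : ℂ :=
  ∑ f ∈ Finset.piAntidiag (Finset.univ : Finset (Fin s)) d,
    ((∏ j, (l j + f j - 1).choose (f j) : ℕ) : ℂ) * F (revWord y (l + f))

theorem rightSum_zero {s : ℕ} (y : Fin s → ℂ) (l : Fin s → ℕ) (d : ℕ) :
    rightSum y l d (fun _ => 0) = 0 := by
  simp [rightSum]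

theorem rightSum_add {s : ℕ} (y : Fin s → ℂ) (l : Fin s → ℕ) (d : ℕ) (F G : List ℂ → ℂ) :
    rightSum y l d (fun w => F w + G w) = rightSum y l d F + rightSum y l d G := by
  simp [rightSum, mul_add, Finset.sum_add_distrib]

theorem tendsto_rightSum {s : ℕ} (y : Fin s → ℂ) (l : Fin s → ℕ) (d : ℕ) {ι : Type*}
    {φ : Filter ι} {F : ι → List ℂ → ℂ} {G : List ℂ → ℂ}
    (h : ∀ f, Tendsto (fun i => F i (revWord y (l + f))) φ (𝓝 (G (revWord y (l + f))))) :
    Tendsto (fun i => rightSum y l d (F i)) φ (𝓝 (rightSum y l d G)) :=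
  tendsto_finsetSum _ fun f _ => (h f).const_mul _

theorem rightSum_onHead_of_eq_zero {s : ℕ} (h : s = 0) (y : Fin s → ℂ) (l : Fin s → ℕ) (d : ℕ)
    (F : List ℂ → ℂ) : rightSum y l d (onHead 1 F) = 0 := by
  subst h
  simp [rightSum, revWord_zero, onHead]

theorem rightSum_onHead_succ {s : ℕ} (y : Fin (s + 1) → ℂ) {l : Fin (s + 1) → ℕ}
    (hl : 1 ≤ l (Fin.last s)) (d : ℕ) (F : List ℂ → ℂ) :
    rightSum y l d (onHead 1 F) = if y (Fin.last s) = 1 ∧ l (Fin.last s) = 1 then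
      rightSum (Fin.init y) (Fin.init l) d F else 0 := by
  have onHead_eq (f : Fin (s + 1) → ℕ) : onHead 1 F (revWord y (l + f)) =
      if (y (Fin.last s) = 1 ∧ l (Fin.last s) = 1) ∧ f (Fin.last s) = 0 then
        F (revWord (Fin.init y) (Fin.init l + Fin.init f)) else 0 := by
    rw [onHead_one_revWord y (hl.trans (Nat.le_add_right _ _)), Pi.add_apply]
    have add_eq_one_iff : l (Fin.last s) + f (Fin.last s) = 1 ↔
        l (Fin.last s) = 1 ∧ f (Fin.last s) = 0 := by omega
    simp only [add_eq_one_iff, and_assoc]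
    rfl
  simp only [rightSum, onHead_eq]
  split_ifs with h
  · refine Eq.trans (Finset.sum_congr rfl fun f _ => ?_) (sum_piAntidiag_ite_last_eq_zero d
      fun f => ((∏ j, (Fin.init l j + f j - 1).choose (f j) : ℕ) : ℂ) *
        F (revWord (Fin.init y) (Fin.init l + f)))
    by_cases hf : f (Fin.last s) = 0
    · simp [h, hf, Fin.prod_univ_castSucc, Fin.init]
    · simp [hf]
  · simp [h]

theorem rightSum_onHead {s s' : ℕ} (h : s = s' + 1) (y : Fin s → ℂ) {l : Fin s → ℕ}
    (hl : ∀ j, 1 ≤ l j) (d : ℕ) (F : List ℂ → ℂ) :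
    rightSum y l d (onHead 1 F) = if y ⟨s', by omega⟩ = 1 ∧ l ⟨s', by omega⟩ = 1 then
      rightSum (fun j : Fin s' => y ⟨j, by omega⟩) (fun j : Fin s' => l ⟨j, by omega⟩) d F
      else 0 := by
  subst h
  exact rightSum_onHead_succ y (hl _) d F

section SymmetricConstruction

variable {r : ℕ} {x : Fin r → ℂ} {k : Fin r → ℕ}

theorem extend_val (x : Fin r → ℂ) (i : Fin r) : extend x i = x i := by
  simp [extend]

theorem extend_mem {X : Set ℂ} (hx : ∀ j, x j ∈ X) (h1 : 1 ∈ X) (j : ℕ) : extend x j ∈ X := by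
  unfold extend
  split_ifs
  exacts [hx _, h1]

/-- The coefficient of the `i`-th summand of the symmetric construction. -/
def symCoeff (a : ℕ) (x : Fin r → ℂ) (k : Fin r → ℕ) (i : Fin (r + 1)) : ℂ :=
  (-1) ^ (∑ j, rightIdx k i j) * extend x i ^ a

theorem sub_castSucc_eq (i : Fin r) : r - i.castSucc.val = r - i.succ.val + 1 := by
  simp only [Fin.val_castSucc, Fin.val_succ]
  omega

theorem rightIdx_castSucc_last (k : Fin r → ℕ) (i : Fin r) :
    rightIdx k i.castSucc ⟨r - i.succ.val, by have := sub_castSucc_eq i; omega⟩ = k i := by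
  unfold rightIdx
  congr 1
  ext
  simp only [Fin.val_succ]
  omega

theorem symCoeff_castSucc (a : ℕ) {i : Fin r} (hxi : x i = extend x (i + 1)) (hki : k i = 1) :
    symCoeff a x k i.castSucc = -symCoeff a x k i.succ := by
  have sum_rightIdx : ∑ j, rightIdx k i.castSucc j = ∑ j, rightIdx k i.succ j + 1 := by
    rw [← (finCongr (sub_castSucc_eq i).symm).sum_comp, Fin.sum_univ_castSucc]
    exact congrArg _ ((rightIdx_castSucc_last k i).trans hki)
  have extend_succ : extend x i.succ.val = extend x i.castSucc.val := by
    rw [Fin.val_succ, ← hxi, Fin.val_castSucc, extend_val]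
  rw [symCoeff, symCoeff, extend_succ, sum_rightIdx, pow_succ]
  ring

theorem onHead_revWord_leftArg_succ (hx : ∀ j, x j ≠ 0) (hk : ∀ j, 1 ≤ k j) (i : Fin r)
    (F : List ℂ → ℂ) :
    onHead 1 F (revWord (leftArg x i.succ) (leftIdx k i.succ)) =
      if x i = extend x (i + 1) ∧ k i = 1 then
        F (revWord (leftArg x i.castSucc) (leftIdx k i.castSucc)) else 0 := by
  have arg_last : leftArg x i.succ (Fin.last i.val) = 1 ↔ x i = extend x (i + 1) :=
    div_eq_one_iff_eq (extend_mem (X := {0}ᶜ) hx one_ne_zero _)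
  refine (onHead_one_revWord (s := i.val) (leftArg x i.succ) (k := leftIdx k i.succ)
    (hk _) F).trans ?_
  simp only [arg_last]
  refine ite_congr rfl (fun h => congrArg F (congrArg₂ revWord ?_ rfl)) fun _ => rfl
  funext j
  simp only [Fin.init, leftArg, Fin.val_succ, ← h.1, Fin.val_castSucc, extend_val]

theorem rightSum_castSucc_onHead (hx : ∀ j, x j ≠ 0) (hk : ∀ j, 1 ≤ k j) (i : Fin r) (d : ℕ)
    (F : List ℂ → ℂ) :
    rightSum (rightArg x i.castSucc) (rightIdx k i.castSucc) d (onHead 1 F) =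
      if x i = extend x (i + 1) ∧ k i = 1 then
        rightSum (rightArg x i.succ) (rightIdx k i.succ) d F else 0 := by
  have hs := sub_castSucc_eq i
  have arg_last : rightArg x i.castSucc ⟨r - i.succ.val, by omega⟩ = 1 ↔
      x i = extend x (i + 1) := by
    simp only [rightArg, Fin.val_succ, Fin.val_castSucc]
    rw [extend_val, div_eq_one_iff_eq (hx i), eq_comm, Nat.sub_sub_self i.isLt]
  rw [rightSum_onHead hs _ (l := rightIdx k i.castSucc) (fun j => hk _), rightIdx_castSucc_last]
  simp only [arg_last]
  refine ite_congr rfl (fun h => ?_) fun _ => rfl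
  congr 1
  funext j
  simp only [rightArg, Fin.val_succ, ← h.1, Fin.val_castSucc, extend_val]

/-- The removal of a leading `1` from the first word of the summand `i + 1` and from the second
words of the summand `i` leads to the same pairs of words, and these come with opposite signs. -/
theorem sum_symCoeff_mul_rightSum_onHead (a : ℕ) (hx : ∀ j, x j ≠ 0) (hk : ∀ j, 1 ≤ k j) (d : ℕ)
    (ψ : List ℂ → ℂ) :
    ∑ i : Fin (r + 1), symCoeff a x k i * rightSum (rightArg x i) (rightIdx k i) d
      (shuffleSum (onHead 1 ψ) (revWord (leftArg x i) (leftIdx k i))) = 0 := by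
  let leftPart (i : Fin (r + 1)) : ℂ := rightSum (rightArg x i) (rightIdx k i) d fun v =>
    onHead 1 (fun w => shuffleSum ψ w v) (revWord (leftArg x i) (leftIdx k i))
  let rightPart (i : Fin (r + 1)) : ℂ := rightSum (rightArg x i) (rightIdx k i) d
    (onHead 1 (shuffleSum ψ (revWord (leftArg x i) (leftIdx k i))))
  have rightSum_eq (i : Fin (r + 1)) : rightSum (rightArg x i) (rightIdx k i) d
      (shuffleSum (onHead 1 ψ) (revWord (leftArg x i) (leftIdx k i))) =
        leftPart i + rightPart i := by
    rw [← rightSum_add]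
    exact congrArg _ (funext fun v => shuffleSum_onHead 1 ψ _ v)
  have leftPart_zero : leftPart 0 = 0 := rightSum_zero _ _ _
  have rightPart_last : rightPart (Fin.last r) = 0 :=
    rightSum_onHead_of_eq_zero (by simp) _ _ _ _
  have cancel (i : Fin r) :
      symCoeff a x k i.succ * leftPart i.succ +
        symCoeff a x k i.castSucc * rightPart i.castSucc = 0 := by
    simp only [leftPart, rightPart, onHead_revWord_leftArg_succ hx hk,
      rightSum_castSucc_onHead hx hk]
    split_ifs with h
    · rw [symCoeff_castSucc a h.1 h.2, neg_mul]
      exact add_neg_cancel _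
    · rw [rightSum_zero, mul_zero, mul_zero, add_zero]
  simp only [rightSum_eq, mul_add, Finset.sum_add_distrib]
  rw [Fin.sum_univ_succ, Fin.sum_univ_castSucc (n := r), leftPart_zero, rightPart_last, mul_zero,
    mul_zero, zero_add, add_zero, ← Finset.sum_add_distrib]
  exact Finset.sum_eq_zero fun i _ => cancel i

/-! ### The symmetric multiple polylogarithm -/

theorem leftArg_mem {X : Set ℂ} (hX : ∀ z ∈ X, ∀ w ∈ X, z / w ∈ X) (h1 : 1 ∈ X)
    (hx : ∀ j, x j ∈ X) (i : Fin (r + 1)) (j : Fin i.val) : leftArg x i j ∈ X :=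
  hX _ (hx _) _ (extend_mem hx h1 _)

theorem rightArg_mem {X : Set ℂ} (hX : ∀ z ∈ X, ∀ w ∈ X, z / w ∈ X) (h1 : 1 ∈ X)
    (hx : ∀ j, x j ∈ X) (i : Fin (r + 1)) (j : Fin (r - i.val)) : rightArg x i j ∈ X :=
  hX _ (extend_mem hx h1 _) _ (extend_mem hx h1 _)

theorem leftArg_ne_zero_and_norm_le_one (hx : ∀ j, ‖x j‖ = 1) (i : Fin (r + 1)) (j : Fin i.val) :
    leftArg x i j ≠ 0 ∧ ‖leftArg x i j‖ ≤ 1 := by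
  have norm_eq_one : ‖leftArg x i j‖ = 1 :=
    leftArg_mem (X := {z | ‖z‖ = 1}) (by simp_all) norm_one hx i j
  exact ⟨ne_zero_of_norm_ne_zero (by simp [norm_eq_one]), norm_eq_one.le⟩

theorem rightArg_ne_zero_and_norm_le_one (hx : ∀ j, ‖x j‖ = 1) (i : Fin (r + 1))
    (j : Fin (r - i.val)) : rightArg x i j ≠ 0 ∧ ‖rightArg x i j‖ ≤ 1 := by
  have norm_eq_one : ‖rightArg x i j‖ = 1 :=
    rightArg_mem (X := {z | ‖z‖ = 1}) (by simp_all) norm_one hx i j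
  exact ⟨ne_zero_of_norm_ne_zero (by simp [norm_eq_one]), norm_eq_one.le⟩

theorem coeff_polylogTrunc_sub_coeff_LSymSh (a : ℕ) (hx : ∀ j, ‖x j‖ = 1) (hk : ∀ j, 1 ≤ k j)
    (d M : ℕ) :
    PowerSeries.coeff d (polylogTrunc a x k M) - PowerSeries.coeff d (LSymSh a x k) =
      (-1) ^ r * ∑ i : Fin (r + 1), symCoeff a x k i * rightSum (rightArg x i) (rightIdx k i) d
        (shuffleSum (truncError M) (revWord (leftArg x i) (leftIdx k i))) := by
  simp only [polylogTrunc, LSymSh, PowerSeries.coeff_mk, rightSum]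
  rw [← Finset.sum_sub_distrib, Finset.mul_sum]
  refine Finset.sum_congr rfl fun i _ => ?_
  rw [← mul_sub, mul_left_comm, ← symCoeff]
  refine congrArg (symCoeff a x k i * ·) ?_
  rw [Finset.mul_sum, Finset.mul_sum, ← Finset.sum_sub_distrib]
  refine Finset.sum_congr rfl fun f _ => ?_
  rw [mul_left_comm (Lsh _ _), ← mul_sub, liProdTrunc_sub_Lsh_mul_Lsh M (k := leftIdx k i)
    (l := rightIdx k i + f) (leftArg_ne_zero_and_norm_le_one hx i) (fun j => hk _)
    (rightArg_ne_zero_and_norm_le_one hx i) (fun j => (hk _).trans (Nat.le_add_right _ _)),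
    mul_left_comm, Nat.add_sub_of_le (Nat.lt_succ_iff.1 i.isLt)]

theorem tendsto_coeff_polylogTrunc (a : ℕ) (hx : ∀ j, ‖x j‖ = 1) (hk : ∀ j, 1 ≤ k j) (d : ℕ) :
    Tendsto (fun M => PowerSeries.coeff d (polylogTrunc a x k M)) atTop
      (𝓝 (PowerSeries.coeff d (LSymSh a x k))) := by
  have hx₀ (j : Fin r) : x j ≠ 0 := ne_zero_of_norm_ne_zero (by simp [hx j])
  have error_eq (M : ℕ) : ∑ i : Fin (r + 1), symCoeff a x k i *
      rightSum (rightArg x i) (rightIdx k i) d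
        (shuffleSum (truncError M) (revWord (leftArg x i) (leftIdx k i))) =
      ∑ i : Fin (r + 1), symCoeff a x k i * rightSum (rightArg x i) (rightIdx k i) d
        (shuffleSum (convError M) (revWord (leftArg x i) (leftIdx k i))) := by
    have split (u : List ℂ) : shuffleSum (truncError M) u = fun v =>
        shuffleSum (onHead 1 fun w => truncError M (1 :: w)) u v + shuffleSum (convError M) u v :=
      funext (shuffleSum_truncError M u)
    simp only [split, rightSum_add, mul_add, Finset.sum_add_distrib]
    rw [sum_symCoeff_mul_rightSum_onHead a hx₀ hk, zero_add]
  have error_tendsto (i : Fin (r + 1)) : Tendsto (fun M => symCoeff a x k i *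
      rightSum (rightArg x i) (rightIdx k i) d
        (shuffleSum (convError M) (revWord (leftArg x i) (leftIdx k i)))) atTop (𝓝 0) := by
    have h := (tendsto_rightSum (rightArg x i) (rightIdx k i) d (G := fun _ => 0) fun f =>
      tendsto_shuffleSum_convError (leftArg_ne_zero_and_norm_le_one hx i) (leftIdx k i)
        (rightArg_ne_zero_and_norm_le_one hx i) (rightIdx k i + f)).const_mul (symCoeff a x k i)
    rwa [rightSum_zero, mul_zero] at h
  rw [← tendsto_sub_nhds_zero_iff]
  simp only [coeff_polylogTrunc_sub_coeff_LSymSh a hx hk, error_eq]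
  simpa using (tendsto_finsetSum Finset.univ fun i _ => error_tendsto i).const_mul ((-1 : ℂ) ^ r)

theorem coeff_LSymSh_mem_lValueSpan {X : Set ℂ} (hX : ∀ z ∈ X, z ≠ 0 ∧ ‖z‖ ≤ 1)
    (hdiv : ∀ z ∈ X, ∀ w ∈ X, z / w ∈ X) (h1 : 1 ∈ X) (a : ℕ) (hx : ∀ j, x j ∈ X) (k : Fin r → ℕ)
    {K : Subfield ℂ} (hK : ∀ j, x j ^ a ∈ K) (d : ℕ) :
    PowerSeries.coeff d (LSymSh a x k) ∈ lValueSpan K X := by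
  have mul_mem_span (c : ℂ) (hc : c ∈ K) (v : ℂ) (hv : v ∈ lValueSpan K X) :
      c * v ∈ lValueSpan K X := (lValueSpan K X).smul_mem (⟨c, hc⟩ : K) hv
  have extend_pow_mem (i : ℕ) : extend x i ^ a ∈ K :=
    extend_mem (X := {z | z ^ a ∈ K}) hK (by simp) i
  rw [LSymSh, PowerSeries.coeff_mk]
  refine sum_mem fun i _ => mul_mem_span _
    (mul_mem (pow_mem (neg_mem (one_mem K)) _) (extend_pow_mem i)) _ ?_
  rw [Finset.mul_sum]
  refine sum_mem fun f _ => ?_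
  rw [mul_left_comm]
  exact mul_mem_span _ (natCast_mem K _) _ (Lsh_mul_Lsh_mem_lValueSpan K hX
    (leftArg_mem hdiv h1 hx i) _ (rightArg_mem hdiv h1 hx i) _)

end SymmetricConstruction
end TAdicSymmetric

end

theorem mainTheorem12_general {Γ : Set ℂ} (hΓ : ∀ z ∈ Γ, ‖z‖ = 1)
    (hdiv : ∀ z ∈ Γ, ∀ w ∈ Γ, z / w ∈ Γ) (h1 : 1 ∈ Γ) (a : ℕ) {r : ℕ} {η : Fin r → ℂ}
    (hη : ∀ j, η j ∈ Γ) {k : Fin r → ℕ} (hk : ∀ j, 1 ≤ k j) :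
    (∀ d, Tendsto (fun M => PowerSeries.coeff d (TAdicSymmetric.polylogTrunc a η k M)) atTop
      (𝓝 (PowerSeries.coeff d (TAdicSymmetric.LSymSh a η k)))) ∧
    ∀ K : Subfield ℂ, (∀ j, η j ^ a ∈ K) → ∀ d,
      PowerSeries.coeff d (TAdicSymmetric.LSymSh a η k) ∈ TAdicSymmetric.lValueSpan K Γ :=
  ⟨TAdicSymmetric.tendsto_coeff_polylogTrunc a (fun j => hΓ _ (hη j)) hk, fun _ hK =>
    TAdicSymmetric.coeff_LSymSh_mem_lValueSpan
      (fun z hz => ⟨ne_zero_of_norm_ne_zero (by simp [hΓ z hz]), (hΓ z hz).le⟩) hdiv h1 a hη k hK⟩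

theorem mainTheorem12 (N : ℕ) (hN : 1 ≤ N) (α : ZMod N) (r : ℕ)
    (η : Fin r → ℂ) (hη : ∀ j, η j ^ N = 1) (k : Fin r → ℕ) (hk : ∀ j, 1 ≤ k j) :
    ∃ S : PowerSeries ℂ,
      (∀ d : ℕ, Tendsto
        (fun M : ℕ => PowerSeries.coeff d (TAdicSymmetric.polylogTrunc α.val η k M))
        atTop (𝓝 (PowerSeries.coeff d S))) ∧
      S = TAdicSymmetric.LSymSh α.val η k ∧
      ∀ K : Subfield ℂ, (∀ j, η j ^ α.val ∈ K) → ∀ d : ℕ,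
        PowerSeries.coeff d S ∈ TAdicSymmetric.LSpace K N ∧
        (TAdicSymmetric.piSqLSpace K N).mkQ (PowerSeries.coeff d S) =
          TAdicSymmetric.LSym K N α η k d := by
  have general := mainTheorem12_general (Γ := {z | z ^ N = 1})
    (fun z hz => Complex.norm_eq_one_of_pow_eq_one hz (by omega))
    (fun z (hz : z ^ N = 1) w (hw : w ^ N = 1) => by simp [div_pow, hz, hw]) (one_pow N) α.val hη hk
  exact ⟨_, general.1, rfl, fun K hK d => ⟨general.2 K hK d, rfl⟩⟩
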